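/- Let $E^3_1$ be $\mathbb{R}^3$ with the Lorentzian metric $\langle\cdot,\cdot\rangle=dx^2+dy^2-dz^2$; a congruence is a map $p\mapsto Tp+v$ with $T$ linear and $\langle\cdot,\cdot\rangle$-preserving. Let $I\subset\mathbb{R}$ be a nonempty open interval, and let $\boldsymbol{x}:I\times\mathbb{R}\to E^3_1$ be a smooth surface of revolution, that is, up to a congruence, $\boldsymbol{x}(s,\theta)$ is one of $$(f\cosh\theta,\,g,\,f\sinh\theta),\qquad (f\sinh\theta,\,g,\,f\cosh\theta),\qquad (f\cos\theta,\,f\sin\theta,\,g)\qquad(f>0),$$ $$\big(\theta h,\ g+\tfrac12\theta^2h,\ f+\tfrac12\theta^2h\big),\qquad h=f-g\neq0\ \text{everywhere},$$ where $f=f(s)$, $g=g(s)$ are smooth on $I$ (spacelike axis for the first two, timelike axis for the third, null axis for the fourth). Assume that $\boldsymbol{x}$ is non-degenerate ($EG-F^2\ne0$ everywhere) and has no parabolic points ($LN-M^2\neq0$ everywhere), where $E,F,G$ and $L,M,N$ are the coefficients of the first and second fundamental forms. Let $\boldsymbol n$ be the unit normal, $e_{km}=\langle\partial_k\boldsymbol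 n,\partial_m\boldsymbol n\rangle$ the third fundamental form, $(e^{km})$ its inverse matrix, $e=\det(e_{km})$, and $$\Delta^{III}p=-\frac1{\sqrt{|e|}}\,\partial_m\!\left(\sqrt{|e|}\,e^{km}\,\partial_kp\right).$$ **Theorem (Classification).** If there is a real $3\times3$ matrix $A$ with $\Delta^{III}\boldsymbol{x}=A\boldsymbol{x}$ on $I\times\mathbb{R}$ ($\Delta^{III}$ acting on each coordinate), then the image $M$ of $\boldsymbol{x}$ is an open part (a relatively open subset) of one of the following: 1. a surface congruent to one of the catenoids, for some $a>0$: - 1st kind: $x^2+y^2=a^2\sinh^2(z/a)$, $\sinh(z/a)\ne0$; - 2nd kind: $z^2-x^2=a^2\sin^2(y/a)$, $\sin(y/a)\neq0$; - 3rd kind: $x^2+y^2=a^2\sin^2(z/a)$, $\sin(z/a)\ne0$; - 4th kind: $z^2-x^2=a^2\sinh^2(y/a)$, $\sinh(y/a)\ne0$; - 5th kind: $x^2-z^2=a^2\cosh^2(y/a)$; 2. a surface congruent, for some $a>0$, to the surface of Enneper of the 2nd kind, $x^2+y^2-z^2=a(y-z)^4$, $y\neq z$, or of the 3rd kind, $x^2+y^2-z^2=-a(y-z)^4$,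 $y\ne z$; 3. the pseudosphere $\mathbb{S}^2_1(0,c)=\{x^2+y^2-z^2=c^2\}$ for some $c>0$; 4. the hyperbolic space $\mathbb{H}^2_1(0,c)=\{x^2+y^2-z^2=-c^2\}$ (both sheets allowed) for some $c>0$. -/

import Mathlib

open scoped ContDiff

noncomputable section

namespace Minkowski3

/-- The vector space underlying `E^3_1`, with rectangular coordinates `x = p 0`, `y = p 1`,
`z = p 2`. -/
abbrev E31 : Type := Fin 3 → ℝ

/-- The Lorentzian metric `dx² + dy² - dz²`. -/
def lorentz (u w : E31) : ℝ := u 0 * w 0 + u 1 * w 1 - u 2 * w 2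

/-- The Lorentzian cross product, characterised by `lorentz (u × w) v = det (u, w, v)`. -/
def cross (u w : E31) : E31 :=
  ![u 1 * w 2 - u 2 * w 1, u 2 * w 0 - u 0 * w 2, -(u 0 * w 1 - u 1 * w 0)]

theorem lorentz_cross (u w v : E31) :
    lorentz (cross u w) v = Matrix.det (Matrix.of ![u, w, v]) := by
  simp [lorentz, cross, Matrix.det_fin_three]
  ring

/-- The congruences of `E^3_1`: a linear map preserving the metric, followed by a translation.
(Such a linear map is automatically bijective.) -/
def IsCongruence (φ : E31 → E31) : Prop :=
  ∃ (T : E31 →ₗ[ℝ] E31) (v : E31),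
    (∀ u w, lorentz (T u) (T w) = lorentz u w) ∧ ∀ p, φ p = T p + v

/-! ### Fundamental forms of a parametrised surface `X (s, θ)` -/

/-- Partial derivative in the first parameter `s`. -/
def dS {V : Type} [NormedAddCommGroup V] [NormedSpace ℝ V] (p : ℝ → ℝ → V) (s θ : ℝ) : V :=
  deriv (fun t => p t θ) s

/-- Partial derivative in the second parameter `θ`. -/
def dθ {V : Type} [NormedAddCommGroup V] [NormedSpace ℝ V] (p : ℝ → ℝ → V) (s θ : ℝ) : V :=
  deriv (fun t => p s t) θ

/-- The first fundamental form, with entries `E`, `F`, `G`. -/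
def firstForm (X : ℝ → ℝ → E31) (s θ : ℝ) : Matrix (Fin 2) (Fin 2) ℝ :=
  !![lorentz (dS X s θ) (dS X s θ), lorentz (dS X s θ) (dθ X s θ);
     lorentz (dS X s θ) (dθ X s θ), lorentz (dθ X s θ) (dθ X s θ)]

/-- The Gauss map: the unit normal `n`, with `⟨n, n⟩ = ±1` where the surface is non-degenerate. -/
def unitNormal (X : ℝ → ℝ → E31) (s θ : ℝ) : E31 :=
  (Real.sqrt |lorentz (cross (dS X s θ) (dθ X s θ)) (cross (dS X s θ) (dθ X s θ))|)⁻¹ •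
    cross (dS X s θ) (dθ X s θ)

/-- The second fundamental form, with entries `L`, `M`, `N`. -/
def secondForm (X : ℝ → ℝ → E31) (s θ : ℝ) : Matrix (Fin 2) (Fin 2) ℝ :=
  !![lorentz (dS (dS X) s θ) (unitNormal X s θ), lorentz (dθ (dS X) s θ) (unitNormal X s θ);
     lorentz (dθ (dS X) s θ) (unitNormal X s θ), lorentz (dθ (dθ X) s θ) (unitNormal X s θ)]

/-- The third fundamental form `⟨dn, dn⟩`. -/
def thirdForm (X : ℝ → ℝ → E31) (s θ : ℝ) : Matrix (Fin 2) (Fin 2) ℝ :=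
  !![lorentz (dS (unitNormal X) s θ) (dS (unitNormal X) s θ),
     lorentz (dS (unitNormal X) s θ) (dθ (unitNormal X) s θ);
     lorentz (dS (unitNormal X) s θ) (dθ (unitNormal X) s θ),
     lorentz (dθ (unitNormal X) s θ) (dθ (unitNormal X) s θ)]

/-- `√|e|`, where `e` is the determinant of the third fundamental form. -/
def sqrtDetIII (X : ℝ → ℝ → E31) (s θ : ℝ) : ℝ := Real.sqrt |(thirdForm X s θ).det|

/-- The Laplace operator of the third fundamental form,
`Δ^{III} p = -(1/√|e|) ∂_m (√|e| e^{km} ∂_k p)`. -/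
def laplaceIII (X : ℝ → ℝ → E31) (p : ℝ → ℝ → ℝ) (s θ : ℝ) : ℝ :=
  -(1 / sqrtDetIII X s θ) *
    (dS (fun s θ => sqrtDetIII X s θ *
        ((thirdForm X s θ)⁻¹ 0 0 * dS p s θ + (thirdForm X s θ)⁻¹ 1 0 * dθ p s θ)) s θ
      + dθ (fun s θ => sqrtDetIII X s θ *
        ((thirdForm X s θ)⁻¹ 0 1 * dS p s θ + (thirdForm X s θ)⁻¹ 1 1 * dθ p s θ)) s θ)

/-! ### Surfaces of revolution -/

/-- Spacelike axis (the `y`-axis), profile curve `(f, g, 0)` in the spacelike `xy`-plane. -/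
def revSpacelike₁ (f g : ℝ → ℝ) (s θ : ℝ) : E31 :=
  ![f s * Real.cosh θ, g s, f s * Real.sinh θ]

/-- Spacelike axis (the `y`-axis), profile curve `(0, g, f)` in the timelike `yz`-plane. -/
def revSpacelike₂ (f g : ℝ → ℝ) (s θ : ℝ) : E31 :=
  ![f s * Real.sinh θ, g s, f s * Real.cosh θ]

/-- Timelike axis (the `z`-axis), profile curve `(f, 0, g)` in the `xz`-plane. -/
def revTimelike (f g : ℝ → ℝ) (s θ : ℝ) : E31 :=
  ![f s * Real.cos θ, f s * Real.sin θ, g s]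

/-- Null axis (spanned by `(0, 1, 1)`), profile curve `(0, g, f)` in the `yz`-plane. -/
def revNull (f g : ℝ → ℝ) (s θ : ℝ) : E31 :=
  ![θ * (f s - g s), g s + θ ^ 2 / 2 * (f s - g s), f s + θ ^ 2 / 2 * (f s - g s)]

/-- The four normal forms of a revolved profile curve over the parameter interval `I`, the curve
not meeting the axis. -/
def IsStandardRevolution (I : Set ℝ) (f g : ℝ → ℝ) (Y : ℝ → ℝ → E31) : Prop :=
  ((∀ s ∈ I, 0 < f s) ∧ Y = revSpacelike₁ f g) ∨
  ((∀ s ∈ I, 0 < f s) ∧ Y = revSpacelike₂ f g) ∨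
  ((∀ s ∈ I, 0 < f s) ∧ Y = revTimelike f g) ∨
  ((∀ s ∈ I, f s - g s ≠ 0) ∧ Y = revNull f g)

/-- `X`, restricted to `I × ℝ`, is a smooth non-degenerate surface of revolution with profile curve
parametrised by the open interval `I`. The axis may be any line: up to a congruence the surface is
in one of the four normal forms. -/
def IsSurfaceOfRevolution (I : Set ℝ) (X : ℝ → ℝ → E31) : Prop :=
  IsOpen I ∧ IsConnected I ∧
  (∃ (f g : ℝ → ℝ) (Y : ℝ → ℝ → E31) (φ : E31 → E31),
    ContDiffOn ℝ ∞ f I ∧ ContDiffOn ℝ ∞ g I ∧ IsStandardRevolution I f g Y ∧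
    IsCongruence φ ∧ ∀ s ∈ I, ∀ θ, X s θ = φ (Y s θ)) ∧
  ∀ s ∈ I, ∀ θ, (firstForm X s θ).det ≠ 0

/-- The surface as a point set. -/
def trace (I : Set ℝ) (X : ℝ → ℝ → E31) : Set E31 :=
  {p | ∃ s ∈ I, ∃ θ, p = X s θ}

/-! ### The model surfaces -/

/-- Catenoid of the 1st kind (spacelike, timelike axis). -/
def catenoid₁ (a : ℝ) : Set E31 :=
  {p | p 0 ^ 2 + p 1 ^ 2 = a ^ 2 * Real.sinh (p 2 / a) ^ 2 ∧ Real.sinh (p 2 / a) ≠ 0}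

/-- Catenoid of the 2nd kind (spacelike, spacelike axis). -/
def catenoid₂ (a : ℝ) : Set E31 :=
  {p | p 2 ^ 2 - p 0 ^ 2 = a ^ 2 * Real.sin (p 1 / a) ^ 2 ∧ Real.sin (p 1 / a) ≠ 0}

/-- Catenoid of the 3rd kind (timelike, timelike axis). -/
def catenoid₃ (a : ℝ) : Set E31 :=
  {p | p 0 ^ 2 + p 1 ^ 2 = a ^ 2 * Real.sin (p 2 / a) ^ 2 ∧ Real.sin (p 2 / a) ≠ 0}

/-- Catenoid of the 4th kind (timelike, spacelike axis, profile curve in a timelike plane). -/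
def catenoid₄ (a : ℝ) : Set E31 :=
  {p | p 2 ^ 2 - p 0 ^ 2 = a ^ 2 * Real.sinh (p 1 / a) ^ 2 ∧ Real.sinh (p 1 / a) ≠ 0}

/-- Catenoid of the 5th kind (timelike, spacelike axis, profile curve in a spacelike plane). -/
def catenoid₅ (a : ℝ) : Set E31 :=
  {p | p 0 ^ 2 - p 2 ^ 2 = a ^ 2 * Real.cosh (p 1 / a) ^ 2}

/-- Surface of Enneper of the 2nd kind (spacelike, null axis). In the null parametrisation it has
the profile `f = k - s`, `g = k + s`, `k = 4 a s ^ 3`, `s ≠ 0`. -/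
def enneper₂ (a : ℝ) : Set E31 :=
  {p | p 0 ^ 2 + p 1 ^ 2 - p 2 ^ 2 = a * (p 1 - p 2) ^ 4 ∧ p 1 - p 2 ≠ 0}

/-- Surface of Enneper of the 3rd kind (timelike, null axis). In the null parametrisation it has
the profile `f = k - s`, `g = k + s`, `k = -4 a s ^ 3`, `s ≠ 0`. -/
def enneper₃ (a : ℝ) : Set E31 :=
  {p | p 0 ^ 2 + p 1 ^ 2 - p 2 ^ 2 = -a * (p 1 - p 2) ^ 4 ∧ p 1 - p 2 ≠ 0}

/-- The pseudosphere `S^2_1(0, c)`. -/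
def pseudosphere (c : ℝ) : Set E31 := {p | lorentz p p = c ^ 2}

/-- The hyperbolic space `H^2(0, c)` (pseudosphere of imaginary radius; both sheets). -/
def hyperbolicSpace (c : ℝ) : Set E31 := {p | lorentz p p = -c ^ 2}

/-- `M` is an open part of `S`: a relatively open subset. -/
def IsOpenPart (M S : Set E31) : Prop := ∃ U : Set E31, IsOpen U ∧ M = S ∩ U

/-- `M` is an open part of a surface congruent to a member `S a`, `a > 0`, of the family `S`. -/
def IsOpenPartOfCopy (M : Set E31) (S : ℝ → Set E31) : Prop :=
  ∃ a : ℝ, 0 < a ∧ ∃ φ : E31 → E31, IsCongruence φ ∧ IsOpenPart M (φ '' S a)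

end Minkowski3

end

noncomputable section

set_option linter.unusedSimpArgs false

namespace Minkowski3

/-! ### Algebra of the Lorentzian metric and cross product -/

/-! All four normal forms are treated through a frame `C θ`, `D θ = C' θ`, `e` with `D' = τ C + κ
e`, in which `X = p C + r e + v` with `p`, `r` functions of `s` alone. The third fundamental form is
then diagonal and independent of `θ`, so `Δ^{III} X = Φ C + Ψ e` with `Φ`, `Ψ` depending only on
`s`. Differentiating `Φ C + Ψ e = A X` in `θ` shows that `A` respects the rotation, and what remains
is a pair of ordinary differential equations for the profile: `Φ = l p`, together with `Ψ = μ (r +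
z)` when the axis is not null and `Ψ = l (r + z) + ν (p + x)` when it is
(`RotationFrame.eigen_nonnull`, `RotationFrame.eigen_null`).

Let `(a, b)` be the unit tangent of the profile, `j` its turning rate and `ρ` its signed radius of
curvature. Absence of parabolic points makes the turning angle a legitimate parameter. The decisive
quantity is `R`, up to sign the sum `2H/K` of the two principal radii. The equations are linear in
`R` and its angular derivative `R₁`; solving for both and differentiating once gives `R₁` as a
constant multiple of `ρ a b` (of `ρ a ^ 2` for a null axis). If that constant is nonzero, a
nontrivial quadratic polynomial vanishes along a nonconstant function, a contradiction. Hence `R` is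
constant. Either `l = 0` and `R = 0`, so the surface is minimal, or `l ≠ 0`, both principal radii
equal the same constant, and the profile is that of a sphere (`profile_nonnull`, `profile_null`).

Minimal profiles integrate to `cosh`, `sinh` or `sin` (catenoids), or to a cubic for a null axis
(Enneper). In the spherical case `l ≠ 0` also forces the axis through the origin, so the spheres are
centred at `0`, while minimal surfaces are determined only up to congruence. -/

theorem lorentz_add_left (u u' w : E31) : lorentz (u + u') w = lorentz u w + lorentz u' w := by
  simp [lorentz]; ring

theorem lorentz_add_right (u w w' : E31) : lorentz u (w + w') = lorentz u w + lorentz u w' := by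
  simp [lorentz]; ring

theorem lorentz_smul_left (c : ℝ) (u w : E31) : lorentz (c • u) w = c * lorentz u w := by
  simp [lorentz]; ring

theorem lorentz_smul_right (c : ℝ) (u w : E31) : lorentz u (c • w) = c * lorentz u w := by
  simp [lorentz]; ring

theorem lorentz_comm (u w : E31) : lorentz u w = lorentz w u := by
  simp [lorentz]; ring

theorem cross_add_left (u u' w : E31) : cross (u + u') w = cross u w + cross u' w := by
  ext i; fin_cases i <;> simp [cross] <;> ring

theorem cross_smul_left (c : ℝ) (u w : E31) : cross (c • u) w = c • cross u w := by
  ext i; fin_cases i <;> simp [cross] <;> ring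

theorem cross_smul_right (c : ℝ) (u w : E31) : cross u (c • w) = c • cross u w := by
  ext i; fin_cases i <;> simp [cross] <;> ring

theorem eq_of_lorentz_eq {u w : E31} (h : ∀ z, lorentz u z = lorentz w z) : u = w := by
  ext i
  fin_cases i
  · simpa [lorentz] using h ![1, 0, 0]
  · simpa [lorentz] using h ![0, 1, 0]
  · simpa [lorentz] using h ![0, 0, 1]

theorem injective_of_lorentz {T : E31 →ₗ[ℝ] E31}
    (hT : ∀ u w, lorentz (T u) (T w) = lorentz u w) : Function.Injective T := by
  rw [injective_iff_map_eq_zero]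
  intro u hu
  refine eq_of_lorentz_eq fun z => ?_
  rw [← hT, hu]
  simp [lorentz]

theorem surjective_of_lorentz {T : E31 →ₗ[ℝ] E31}
    (hT : ∀ u w, lorentz (T u) (T w) = lorentz u w) : Function.Surjective T :=
  LinearMap.injective_iff_surjective.1 (injective_of_lorentz hT)

theorem det_of_apply (T : E31 →ₗ[ℝ] E31) (u w z : E31) :
    Matrix.det (Matrix.of ![T u, T w, T z])
      = LinearMap.det T * Matrix.det (Matrix.of ![u, w, z]) := by
  have h : Matrix.of ![T u, T w, T z] = Matrix.of ![u, w, z] * (LinearMap.toMatrix' T).transpose := by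
    ext i k
    have key : ∀ x : E31, T x k = ∑ l, x l * LinearMap.toMatrix' T k l := by
      intro x
      conv_lhs => rw [← LinearMap.toMatrix'_mulVec T x]
      simp [Matrix.mulVec, dotProduct, mul_comm]
    fin_cases i
    · simpa [Matrix.mul_apply] using key u
    · simpa [Matrix.mul_apply] using key w
    · simpa [Matrix.mul_apply] using key z
  rw [h, Matrix.det_mul, Matrix.det_transpose, LinearMap.det_toMatrix', mul_comm]

/-- The Gram determinant is minus the square of the volume. -/
theorem gram_eq_neg_det_sq (u w z : E31) :
    Matrix.det !![lorentz u u, lorentz u w, lorentz u z; lorentz w u, lorentz w w, lorentz w z;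
      lorentz z u, lorentz z w, lorentz z z] = -(Matrix.det (Matrix.of ![u, w, z])) ^ 2 := by
  simp [Matrix.det_fin_three, lorentz]
  ring

/-- The Gram determinant of a basis is preserved by `T` but is also multiplied by `det T ^ 2`. -/
theorem det_sq_of_lorentz {T : E31 →ₗ[ℝ] E31}
    (hT : ∀ u w, lorentz (T u) (T w) = lorentz u w) : LinearMap.det T ^ 2 = 1 := by
  have h := gram_eq_neg_det_sq (T ![1, 0, 0]) (T ![0, 1, 0]) (T ![0, 0, 1])
  rw [det_of_apply] at h
  simp only [hT] at h
  rw [gram_eq_neg_det_sq] at h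
  have h1 : Matrix.det (Matrix.of ![![1, 0, 0], ![0, 1, 0], ![0, 0, (1 : ℝ)]]) = 1 := by
    simp [Matrix.det_fin_three]
  rw [h1] at h
  linear_combination h

/-- The cross product is dual to the volume form, which `T` multiplies by its determinant. This sign
becomes the `χ` of the classification lemmas. -/
theorem cross_apply_apply {T : E31 →ₗ[ℝ] E31}
    (hT : ∀ u w, lorentz (T u) (T w) = lorentz u w) (u w : E31) :
    cross (T u) (T w) = LinearMap.det T • T (cross u w) := by
  refine eq_of_lorentz_eq fun z => ?_
  obtain ⟨z, rfl⟩ := surjective_of_lorentz hT z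
  rw [lorentz_cross, det_of_apply, lorentz_smul_left, hT, lorentz_cross]

/-! ### Rotation frames -/

section Deriv

variable {V : Type} [NormedAddCommGroup V] [NormedSpace ℝ V]

/-- The target is a general normed space so that the rule serves the surface, its derivatives and
its normal, and also the scalar coordinate functions inside `laplaceIII`. -/
theorem dS_rotation {I : Set ℝ} (hI : IsOpen I) {Z : ℝ → ℝ → V} {C : ℝ → V} {e v : V}
    {p r : ℝ → ℝ} {p' r' : ℝ} {s θ : ℝ} (hs : s ∈ I) (hp : HasDerivAt p p' s)
    (hr : HasDerivAt r r' s)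
    (hZ : ∀ s ∈ I, ∀ θ, Z s θ = p s • C θ + r s • e + v) :
    dS Z s θ = p' • C θ + r' • e := by
  have h : (fun t => Z t θ) =ᶠ[nhds s] fun t => p t • C θ + r t • e + v := by
    filter_upwards [hI.mem_nhds hs] with t ht using hZ t ht θ
  rw [dS, h.deriv_eq]
  exact (((hp.smul_const (C θ)).add (hr.smul_const e)).add_const v).deriv

theorem dθ_rotation {Z : ℝ → ℝ → V} {C : ℝ → V} {C' e v : V}
    {p r s θ : ℝ} (hC : HasDerivAt C C' θ) (hZ : ∀ θ, Z s θ = p • C θ + r • e + v) :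
    dθ Z s θ = p • C' := by
  rw [dθ, funext hZ]
  exact (((hC.const_smul p).add_const _).add_const v).deriv

end Deriv

/-- The moving frame `C, D = C', e` of a one-parameter group of rotations: `D` is orthogonal to
the plane of the profile curve, spanned by `C` and `e`, and `e` is fixed. -/
structure RotationFrame (C D : ℝ → E31) (e : E31) (τ κ α β γ ε : ℝ) : Prop where
  hasDerivAt_C : ∀ θ, HasDerivAt C (D θ) θ
  hasDerivAt_D : ∀ θ, HasDerivAt D (τ • C θ + κ • e) θ
  CC : ∀ θ, lorentz (C θ) (C θ) = α
  Ce : ∀ θ, lorentz (C θ) e = β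
  ee : lorentz e e = γ
  DD : ∀ θ, lorentz (D θ) (D θ) = ε
  CD : ∀ θ, lorentz (C θ) (D θ) = 0
  eD : ∀ θ, lorentz e (D θ) = 0
  -- `rel_C` and `rel_e` are the derivatives in `θ` of `CD` and `eD`.
  rel_C : ε + α * τ + β * κ = 0
  rel_e : β * τ + γ * κ = 0
  gram : α * γ - β ^ 2 ≠ 0
  ε_sq : ε ^ 2 = 1

/-! ### Fundamental forms and `Δ^{III}` in a rotation frame -/

namespace RotationFrame

variable {C D : ℝ → E31} {e : E31} {τ κ α β γ ε : ℝ}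

theorem eC (F : RotationFrame C D e τ κ α β γ ε) (θ : ℝ) : lorentz e (C θ) = β := by
  rw [lorentz_comm, F.Ce]
theorem DC (F : RotationFrame C D e τ κ α β γ ε) (θ : ℝ) : lorentz (D θ) (C θ) = 0 := by
  rw [lorentz_comm, F.CD]
theorem De (F : RotationFrame C D e τ κ α β γ ε) (θ : ℝ) : lorentz (D θ) e = 0 := by
  rw [lorentz_comm, F.eD]

/-- Pairing with `D` isolates `y`, since `ε ≠ 0`; pairing with `C` and `e` leaves a 2 × 2 system
whose determinant is the one in `gram`. -/
theorem coords_eq_zero (F : RotationFrame C D e τ κ α β γ ε) {x y z θ : ℝ}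
    (h : x • C θ + y • D θ + z • e = 0) : x = 0 ∧ y = 0 ∧ z = 0 := by
  have hε : ε ≠ 0 := fun h => by simpa [h] using F.ε_sq
  have key : ∀ u, lorentz (x • C θ + y • D θ + z • e) u = 0 := fun u => by
    rw [h]; simp [lorentz]
  have h1 := key (C θ)
  have h2 := key (D θ)
  have h3 := key e
  simp only [lorentz_add_left, lorentz_smul_left, F.CC, F.CD, F.Ce, F.DC, F.DD, F.De, F.ee,
    F.eC, F.eD] at h1 h2 h3
  refine ⟨?_, ?_, ?_⟩
  · refine (mul_eq_zero.1 (?_ : x * (α * γ - β ^ 2) = 0)).resolve_right F.gram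
    linear_combination γ * h1 - β * h3
  · refine (mul_eq_zero.1 (?_ : y * ε = 0)).resolve_right hε
    linear_combination h2
  · refine (mul_eq_zero.1 (?_ : z * (α * γ - β ^ 2) = 0)).resolve_right F.gram
    linear_combination α * h3 - β * h1

variable {I : Set ℝ} {X : ℝ → ℝ → E31} {v : E31} {p r p' r' p'' r'' : ℝ → ℝ}

theorem firstForm_det (F : RotationFrame C D e τ κ α β γ ε) (hI : IsOpen I)
    (hX : ∀ s ∈ I, ∀ θ, X s θ = p s • C θ + r s • e + v)
    (hp : ∀ s ∈ I, HasDerivAt p (p' s) s) (hr : ∀ s ∈ I, HasDerivAt r (r' s) s)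
    {s : ℝ} (hs : s ∈ I) (θ : ℝ) :
    (firstForm X s θ).det
      = (α * p' s ^ 2 + 2 * β * p' s * r' s + γ * r' s ^ 2) * (ε * p s ^ 2) := by
  rw [firstForm, dS_rotation hI hs (hp s hs) (hr s hs) hX,
    dθ_rotation (F.hasDerivAt_C θ) (hX s hs), Matrix.det_fin_two_of]
  simp only [lorentz_add_left, lorentz_smul_left, lorentz_add_right, lorentz_smul_right,
    F.CC, F.CD, F.Ce, F.DC, F.DD, F.De, F.ee, F.eC, F.eD]
  ring

theorem secondForm_det (F : RotationFrame C D e τ κ α β γ ε) (hI : IsOpen I)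
    (hX : ∀ s ∈ I, ∀ θ, X s θ = p s • C θ + r s • e + v)
    (hp : ∀ s ∈ I, HasDerivAt p (p' s) s) (hr : ∀ s ∈ I, HasDerivAt r (r' s) s)
    (hp' : ∀ s ∈ I, HasDerivAt p' (p'' s) s) (hr' : ∀ s ∈ I, HasDerivAt r' (r'' s) s)
    {s θ n₁ n₂ : ℝ} (hs : s ∈ I) (hn : unitNormal X s θ = n₁ • C θ + n₂ • e) :
    (secondForm X s θ).det
      = (p'' s * (α * n₁ + β * n₂) + r'' s * (β * n₁ + γ * n₂)) * (-(ε * p s * n₁)) := by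
  have h1 : ∀ s ∈ I, ∀ θ, dS X s θ = p' s • C θ + r' s • e + 0 := fun s hs θ => by
    rw [dS_rotation hI hs (hp s hs) (hr s hs) hX, add_zero]
  have h2 : ∀ θ, dθ X s θ = p s • D θ + (0 : ℝ) • e + 0 := fun θ => by
    rw [dθ_rotation (F.hasDerivAt_C θ) (hX s hs)]; simp
  rw [secondForm, dS_rotation hI hs (hp' s hs) (hr' s hs) h1,
    dθ_rotation (F.hasDerivAt_C θ) (h1 s hs), dθ_rotation (F.hasDerivAt_D θ) h2,
    Matrix.det_fin_two_of, hn]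
  simp only [lorentz_add_left, lorentz_smul_left, lorentz_add_right, lorentz_smul_right,
    F.CC, F.CD, F.Ce, F.DC, F.DD, F.De, F.ee, F.eC, F.eD]
  -- The normal component of `∂_θ ∂_θ X = p (τ C + κ e)` is `p (n₁ (α τ + β κ) + n₂ (β τ + γ κ))`;
  -- `rel_C` and `rel_e` reduce it to `-ε p n₁`. The mixed entry vanishes because `D` is orthogonal
  -- to the normal.
  have hε : ε = -(α * τ + β * κ) := by linear_combination F.rel_C
  rw [hε]
  linear_combination (p'' s * (α * n₁ + β * n₂) + r'' s * (β * n₁ + γ * n₂)) * p s * n₂ * F.rel_e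

/-- The third fundamental form of a surface of revolution whose normal turns at the rate `j`
with respect to the unit tangent `a C + b e`. -/
theorem thirdForm_eq (F : RotationFrame C D e τ κ α β γ ε) (hI : IsOpen I)
    {a b j m m₂ : ℝ → ℝ} {s₀ t η : ℝ} (hs₀ : s₀ ^ 2 = 1) (ht : t ^ 2 = 1)
    (hn : ∀ s ∈ I, ∀ θ, unitNormal X s θ = (s₀ * m s) • C θ + (s₀ * m₂ s) • e)
    (hm : ∀ s ∈ I, HasDerivAt m (t * j s * a s) s)
    (hm₂ : ∀ s ∈ I, HasDerivAt m₂ (t * j s * b s) s)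
    (hη : ∀ s ∈ I, α * a s ^ 2 + 2 * β * a s * b s + γ * b s ^ 2 = η)
    {s : ℝ} (hs : s ∈ I) (θ : ℝ) :
    thirdForm X s θ = !![η * j s ^ 2, 0; 0, ε * m s ^ 2] := by
  have h1 : ∀ s ∈ I, ∀ θ, unitNormal X s θ = (s₀ * m s) • C θ + (s₀ * m₂ s) • e + 0 :=
    fun s hs θ => by rw [hn s hs, add_zero]
  rw [thirdForm, dS_rotation hI hs ((hm s hs).const_mul s₀) ((hm₂ s hs).const_mul s₀) h1,
    dθ_rotation (F.hasDerivAt_C θ) (h1 s hs)]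
  simp only [lorentz_add_left, lorentz_smul_left, lorentz_add_right, lorentz_smul_right,
    F.CC, F.CD, F.Ce, F.DC, F.DD, F.De, F.ee, F.eC, F.eD, ← hη s hs]
  have key : ∀ {x₁ x₂ x₃ y₁ y₃ : ℝ}, x₁ = y₁ → x₂ = 0 → x₃ = y₃ →
      !![x₁, x₂; x₂, x₃] = !![y₁, 0; 0, y₃] := by
    rintro _ _ _ _ _ rfl rfl rfl; rfl
  refine key ?_ (by ring) ?_
  · linear_combination (α * a s ^ 2 + 2 * β * a s * b s + γ * b s ^ 2) * j s ^ 2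
      * (t ^ 2 * hs₀ + ht)
  · linear_combination ε * m s ^ 2 * hs₀

/-- Since the form is diagonal, `√|e| = ς j m`, where the constant sign `ς` of `j m` cancels in the
end. The `s`-term differentiates `m ρ (a C + b e)`; the `θ`-term turns `D` into `τ C + κ e`, so the
result stays in the plane of `C` and `e`. -/
theorem laplaceIII_eq (F : RotationFrame C D e τ κ α β γ ε) (hI : IsOpen I)
    {a b j m ρ Pa Pb : ℝ → ℝ} {ς η : ℝ} (hη : η ^ 2 = 1) (hς : ς ^ 2 = 1)
    (hX : ∀ s ∈ I, ∀ θ, X s θ = p s • C θ + r s • e + v)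
    (hIII : ∀ s ∈ I, ∀ θ, thirdForm X s θ = !![η * j s ^ 2, 0; 0, ε * m s ^ 2])
    (hp : ∀ s ∈ I, HasDerivAt p (j s * ρ s * a s) s)
    (hr : ∀ s ∈ I, HasDerivAt r (j s * ρ s * b s) s)
    (hj : ∀ s ∈ I, j s ≠ 0) (hm : ∀ s ∈ I, m s ≠ 0)
    (habs : ∀ s ∈ I, |j s * m s| = ς * (j s * m s))
    (hPa : ∀ s ∈ I, HasDerivAt (fun s => m s * ρ s * a s) (Pa s) s)
    (hPb : ∀ s ∈ I, HasDerivAt (fun s => m s * ρ s * b s) (Pb s) s)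
    {s : ℝ} (hs : s ∈ I) (θ : ℝ) (i : Fin 3) :
    laplaceIII X (fun s θ => X s θ i) s θ
      = (-(η * Pa s + ε * τ * j s * p s / m s) / (j s * m s)) * C θ i
        + (-(η * Pb s + ε * κ * j s * p s / m s) / (j s * m s)) * e i := by
  have hε := F.ε_sq
  have hς0 : ς ≠ 0 := fun h => by simp [h] at hς
  have hXi : ∀ s ∈ I, ∀ θ, X s θ i = p s • C θ i + r s • e i + v i := fun s hs θ => by
    simp [hX s hs]
  have hDi : HasDerivAt (fun θ => D θ i) ((τ • C θ + κ • e) i) θ :=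
    hasDerivAt_pi.1 (F.hasDerivAt_D θ) i
  have hsq : ∀ s ∈ I, ∀ θ, sqrtDetIII X s θ = ς * (j s * m s) := fun s hs θ => by
    rw [sqrtDetIII, hIII s hs, Matrix.det_fin_two_of, ← habs s hs]
    have : |η * j s ^ 2 * (ε * m s ^ 2) - 0 * 0| = (j s * m s) ^ 2 := by
      have h1 : |η| = 1 := by rw [← abs_one, ← sq_eq_sq_iff_abs_eq_abs, hη]; norm_num
      have h2 : |ε| = 1 := by rw [← abs_one, ← sq_eq_sq_iff_abs_eq_abs, hε]; norm_num
      rw [mul_zero, sub_zero, abs_mul, abs_mul, abs_mul, h1, h2, abs_of_nonneg (sq_nonneg _),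
        abs_of_nonneg (sq_nonneg _)]
      ring
    rw [this, Real.sqrt_sq_eq_abs]
  have hinv : ∀ s ∈ I, ∀ θ, (thirdForm X s θ)⁻¹
      = !![η * (j s ^ 2)⁻¹, 0; 0, ε * (m s ^ 2)⁻¹] := fun s hs θ => by
    have h1 := hj s hs
    have h2 := hm s hs
    rw [hIII s hs]
    refine Matrix.inv_eq_right_inv ?_
    ext i k
    fin_cases i <;> fin_cases k <;> simp [Matrix.mul_apply]
    · field_simp; exact hη
    · field_simp; exact hε
  have hdS : ∀ s ∈ I, ∀ θ, dS (fun s θ => X s θ i) s θ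
      = (j s * ρ s * a s) • C θ i + (j s * ρ s * b s) • e i := fun s hs θ =>
    dS_rotation hI hs (hp s hs) (hr s hs) hXi
  have hdθ : ∀ s ∈ I, ∀ θ, dθ (fun s θ => X s θ i) s θ = p s • D θ i := fun s hs θ =>
    dθ_rotation (hasDerivAt_pi.1 (F.hasDerivAt_C θ) i) (hXi s hs)
  have hA : ∀ s ∈ I, ∀ θ, sqrtDetIII X s θ *
        ((thirdForm X s θ)⁻¹ 0 0 * dS (fun s θ => X s θ i) s θ
          + (thirdForm X s θ)⁻¹ 1 0 * dθ (fun s θ => X s θ i) s θ)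
      = (ς * η * (m s * ρ s * a s)) • C θ i + (ς * η * (m s * ρ s * b s)) • e i + 0 :=
    fun s hs θ => by
      have h1 := hj s hs
      rw [hsq s hs, hinv s hs, hdS s hs]
      simp
      field_simp
  have hB : ∀ θ, sqrtDetIII X s θ *
        ((thirdForm X s θ)⁻¹ 0 1 * dS (fun s θ => X s θ i) s θ
          + (thirdForm X s θ)⁻¹ 1 1 * dθ (fun s θ => X s θ i) s θ)
      = (ς * ε * j s * p s / m s) • D θ i + (0 : ℝ) • (0 : ℝ) + 0 :=
    fun θ => by
      have h1 := hm s hs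
      rw [hsq s hs, hinv s hs, hdθ s hs]
      simp
      field_simp
  rw [laplaceIII, dS_rotation hI hs ((hPa s hs).const_mul (ς * η)) ((hPb s hs).const_mul (ς * η)) hA,
    dθ_rotation hDi hB, hsq s hs]
  have h1 := hj s hs
  have h2 := hm s hs
  simp only [smul_eq_mul, Pi.add_apply, Pi.smul_apply]
  field_simp
  ring

end RotationFrame

theorem exists_ne_of_hasDerivAt {I : Set ℝ} (hI : IsOpen I) {r : ℝ → ℝ} {r' s₀ : ℝ}
    (hs₀ : s₀ ∈ I) (hr : HasDerivAt r r' s₀) (hr' : r' ≠ 0) : ∃ s ∈ I, r s ≠ r s₀ := by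
  by_contra! h
  refine hr' (hr.unique ((hasDerivAt_const s₀ (r s₀)).congr_of_eventuallyEq ?_))
  filter_upwards [hI.mem_nhds hs₀] with s hs using h s hs

/-! ### Eigenvectors of the matrix forced by rotational symmetry -/

namespace RotationFrame

variable {C D : ℝ → E31} {e : E31} {τ κ α β γ ε : ℝ} {I : Set ℝ} {v : E31}
  {p r Φ Ψ : ℝ → ℝ} {L : E31 →L[ℝ] E31}

/-- One `θ`-derivative of the relation gives `Φ D = p L D`, a second gives the same for `D'`. The
quotient `Φ / p` is the eigenvalue of the fixed nonzero vector `D 0`, hence does not depend on `s`.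
-/
theorem exists_eigenvalue (F : RotationFrame C D e τ κ α β γ ε)
    (hL : ∀ s ∈ I, ∀ θ, Φ s • C θ + Ψ s • e = L (p s • C θ + r s • e + v))
    (hp : ∀ s ∈ I, p s ≠ 0) {s₀ : ℝ} (hs₀ : s₀ ∈ I) :
    ∃ l : ℝ, (∀ s ∈ I, Φ s = l * p s) ∧ L (D 0) = l • D 0 ∧
      L (τ • C 0 + κ • e) = l • (τ • C 0 + κ • e) := by
  have h1 : ∀ s ∈ I, ∀ θ, Φ s • D θ = p s • L (D θ) := fun s hs θ => by
    have hl : HasDerivAt (fun θ => Φ s • C θ + Ψ s • e) (Φ s • D θ) θ :=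
      ((F.hasDerivAt_C θ).const_smul (Φ s)).add_const _
    have hr : HasDerivAt (fun θ => L (p s • C θ + r s • e + v)) (L (p s • D θ)) θ :=
      L.hasFDerivAt.comp_hasDerivAt θ
        ((((F.hasDerivAt_C θ).const_smul (p s)).add_const _).add_const v)
    rw [funext (hL s hs)] at hl
    rw [hl.unique hr, map_smul]
  have h2 : ∀ s ∈ I, Φ s • (τ • C 0 + κ • e) = p s • L (τ • C 0 + κ • e) := fun s hs => by
    have hl : HasDerivAt (fun θ => Φ s • D θ) (Φ s • (τ • C 0 + κ • e)) 0 :=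
      (F.hasDerivAt_D 0).const_smul (Φ s)
    have hr : HasDerivAt (fun θ => p s • L (D θ)) (p s • L (τ • C 0 + κ • e)) 0 :=
      (L.hasFDerivAt.comp_hasDerivAt 0 (F.hasDerivAt_D 0)).const_smul (p s)
    rw [funext (h1 s hs)] at hl
    exact hl.unique hr
  have h3 : ∀ s ∈ I, L (D 0) = (Φ s / p s) • D 0 := fun s hs => by
    rw [div_eq_inv_mul, mul_smul, h1 s hs, inv_smul_smul₀ (hp s hs)]
  refine ⟨Φ s₀ / p s₀, fun s hs => ?_, h3 s₀ hs₀, ?_⟩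
  · have h4 : (0 : ℝ) • C 0 + (Φ s / p s - Φ s₀ / p s₀) • D 0 + (0 : ℝ) • e = 0 := by
      rw [sub_smul, ← h3 s hs, ← h3 s₀ hs₀]; simp
    have h5 := (F.coords_eq_zero h4).2.1
    have := hp s hs
    field_simp at h5 ⊢
    have h0 := hp s₀ hs₀
    field_simp at h5 ⊢
    linear_combination h5
  · rw [div_eq_inv_mul, mul_smul, h2 s₀ hs₀, inv_smul_smul₀ (hp s₀ hs₀)]

/-- Here `D'` is a multiple of `C`, so `L` acts as `l` on `C 0` and `D 0`. At `θ = 0` this leaves `Ψ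
e = r L e + L v`; subtracting two values of `s` with different `r` makes `e` an eigenvector, and the
components of `L v` off the axis must vanish. -/
theorem eigen_nonnull (F : RotationFrame C D e τ 0 α β γ ε) (hτ : τ ≠ 0)
    (hL : ∀ s ∈ I, ∀ θ, Φ s • C θ + Ψ s • e = L (p s • C θ + r s • e + v))
    (hp : ∀ s ∈ I, p s ≠ 0) {s₀ s₁ : ℝ} (hs₀ : s₀ ∈ I) (hs₁ : s₁ ∈ I) (hr : r s₁ ≠ r s₀)
    {x y z : ℝ} (hv : v = x • C 0 + y • D 0 + z • e) :
    ∃ l μ : ℝ, (∀ s ∈ I, Φ s = l * p s ∧ Ψ s = μ * (r s + z)) ∧ l * x = 0 ∧ l * y = 0 := by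
  obtain ⟨l, h1, h2, h3⟩ := F.exists_eigenvalue hL hp hs₀
  have hC : L (C 0) = l • C 0 := by
    simp only [zero_smul, add_zero, map_smul, smul_comm l τ] at h3
    exact smul_right_injective _ hτ h3
  have h4 : ∀ s ∈ I, Ψ s • e = r s • L e + L v := fun s hs => by
    have := hL s hs 0
    rw [h1 s hs, map_add, map_add, map_smul, map_smul, hC, smul_smul, mul_comm l, add_assoc] at this
    exact add_left_cancel this
  have he : L e = ((Ψ s₁ - Ψ s₀) / (r s₁ - r s₀)) • e := by
    rw [div_eq_inv_mul, mul_smul, sub_smul, h4 s₁ hs₁, h4 s₀ hs₀, add_sub_add_right_eq_sub,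
      ← sub_smul, inv_smul_smul₀ (sub_ne_zero.2 hr)]
  generalize (Ψ s₁ - Ψ s₀) / (r s₁ - r s₀) = μ at he
  have h5 : ∀ s ∈ I, (l * x) • C 0 + (l * y) • D 0 + (μ * (r s + z) - Ψ s) • e = 0 :=
    fun s hs => by
      have := h4 s hs
      rw [hv, map_add, map_add, map_smul, map_smul, map_smul, he, hC, h2] at this
      rw [sub_smul, this]
      module
  have h6 := fun s hs => F.coords_eq_zero (h5 s hs)
  exact ⟨l, μ, fun s hs => ⟨h1 s hs, by linear_combination -(h6 s hs).2.2⟩,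
    (h6 s₀ hs₀).1, (h6 s₀ hs₀).2.1⟩

/-- Here `D'` is a multiple of `e`, so `e` has the eigenvalue `l` as well, but `C 0` is an
eigenvector only modulo `e`; `ν` measures this nilpotent part. -/
theorem eigen_null (F : RotationFrame C D e 0 κ α β γ ε) (hκ : κ ≠ 0)
    (hL : ∀ s ∈ I, ∀ θ, Φ s • C θ + Ψ s • e = L (p s • C θ + r s • e + v))
    (hp : ∀ s ∈ I, p s ≠ 0) {s₀ s₁ : ℝ} (hs₀ : s₀ ∈ I) (hs₁ : s₁ ∈ I) (hps : p s₁ ≠ p s₀)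
    {x y z : ℝ} (hv : v = x • C 0 + y • D 0 + z • e) :
    ∃ l ν : ℝ, (∀ s ∈ I, Φ s = l * p s ∧ Ψ s = l * (r s + z) + ν * (p s + x)) ∧
      l * x = 0 ∧ l * y = 0 := by
  obtain ⟨l, h1, h2, h3⟩ := F.exists_eigenvalue hL hp hs₀
  have he : L e = l • e := by
    simp only [zero_smul, zero_add, map_smul, smul_comm l κ] at h3
    exact smul_right_injective _ hκ h3
  have h4 : ∀ s ∈ I, (Ψ s - l * r s) • e = p s • (L (C 0) - l • C 0) + L v := fun s hs => by
    have := hL s hs 0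
    rw [h1 s hs, map_add, map_add, map_smul, map_smul, he] at this
    rw [sub_smul, eq_sub_of_add_eq' this]
    module
  have hC : L (C 0) - l • C 0
      = (((Ψ s₁ - l * r s₁) - (Ψ s₀ - l * r s₀)) / (p s₁ - p s₀)) • e := by
    rw [div_eq_inv_mul, mul_smul, sub_smul, h4 s₁ hs₁, h4 s₀ hs₀, add_sub_add_right_eq_sub,
      ← sub_smul, inv_smul_smul₀ (sub_ne_zero.2 hps)]
  generalize ((Ψ s₁ - l * r s₁) - (Ψ s₀ - l * r s₀)) / (p s₁ - p s₀) = ν at hC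
  have hC' : L (C 0) = l • C 0 + ν • e := by rw [← hC]; abel
  have h5 : ∀ s ∈ I, (l * x) • C 0 + (l * y) • D 0
      + (l * (r s + z) + ν * (p s + x) - Ψ s) • e = 0 :=
    fun s hs => by
      have := h4 s hs
      rw [hC, hv, map_add, map_add, map_smul, map_smul, map_smul, he, hC', h2, sub_smul] at this
      rw [sub_smul, eq_add_of_sub_eq this]
      module
  have h6 := fun s hs => F.coords_eq_zero (h5 s hs)
  exact ⟨l, ν, fun s hs => ⟨h1 s hs, by linear_combination -(h6 s hs).2.2⟩,
    (h6 s₀ hs₀).1, (h6 s₀ hs₀).2.1⟩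

end RotationFrame

/-! ### The ordinary differential equations for the profile curve -/

theorem const_of_hasDerivAt_zero {I : Set ℝ} (hI : IsOpen I) (hc : IsPreconnected I) {F : ℝ → ℝ}
    (hF : ∀ s ∈ I, HasDerivAt F 0 s) {s₀ : ℝ} (hs₀ : s₀ ∈ I) : ∀ s ∈ I, F s = F s₀ := by
  intro s hs
  exact hI.is_const_of_deriv_eq_zero hc
    (fun t ht => (hF t ht).differentiableAt.differentiableWithinAt)
    (fun t ht => (hF t ht).deriv) hs hs₀

theorem derivs_eq_of_eqOn {I : Set ℝ} (hI : IsOpen I) {F G : ℝ → ℝ} {F' G' s : ℝ}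
    (h : ∀ t ∈ I, F t = G t) (hs : s ∈ I) (hF : HasDerivAt F F' s) (hG : HasDerivAt G G' s) :
    F' = G' := by
  refine hF.unique (hG.congr_of_eventuallyEq ?_)
  filter_upwards [hI.mem_nhds hs] with t ht using h t ht

/-- Differentiate twice and divide by `u'` each time. Connectedness of `J` is not needed, which
allows restriction to an open piece where `u'` does not vanish. -/
theorem quadratic_coeffs_eq_zero {J : Set ℝ} (hJ : IsOpen J) {u u' : ℝ → ℝ} {A B K s₀ : ℝ}
    (hs₀ : s₀ ∈ J) (hu : ∀ s ∈ J, HasDerivAt u (u' s) s) (hu' : ∀ s ∈ J, u' s ≠ 0)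
    (h : ∀ s ∈ J, A + B * u s + K * u s ^ 2 = 0) : A = 0 ∧ B = 0 ∧ K = 0 := by
  have h1 : ∀ s ∈ J, B + 2 * K * u s = 0 := fun s hs => by
    have := derivs_eq_of_eqOn hJ h hs
      ((((hu s hs).const_mul B).const_add A).add (((hu s hs).pow 2).const_mul K))
      (hasDerivAt_const s (0 : ℝ))
    refine (mul_eq_zero.1 (?_ : u' s * (B + 2 * K * u s) = 0)).resolve_left (hu' s hs)
    rw [← this]; push_cast; ring
  have h2 : K = 0 := by
    have := derivs_eq_of_eqOn hJ h1 hs₀ (((hu s₀ hs₀).const_mul (2 * K)).const_add B)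
      (hasDerivAt_const s₀ (0 : ℝ))
    simpa [hu' s₀ hs₀] using this
  have h3 : B = 0 := by simpa [h2] using h1 s₀ hs₀
  exact ⟨by simpa [h2, h3] using h s₀ hs₀, h3, h2⟩

/-- Division by `j` turns `s`-derivatives into derivatives in the turning angle; `ρ₁` is that of
`ρ`. The first outcome is the minimal profile, the second a profile proportional to the rotated unit
tangent, that is, a conic centred on the axis. -/
theorem profile_nonnull {I : Set ℝ} (hI : IsOpen I) (hc : IsPreconnected I) {s₀ : ℝ} (hs₀ : s₀ ∈ I)
    {f g a b j ρ ρ₁ : ℝ → ℝ} {σ τ η l μ : ℝ}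
    (hσ : σ ^ 2 = 1) (hτ : τ ^ 2 = 1) (hη : η ^ 2 = 1)
    (hf : ∀ s ∈ I, HasDerivAt f (j s * ρ s * a s) s)
    (hg : ∀ s ∈ I, HasDerivAt g (j s * ρ s * b s) s)
    (ha : ∀ s ∈ I, HasDerivAt a (j s * b s) s)
    (hb : ∀ s ∈ I, HasDerivAt b (-(σ * τ) * j s * a s) s)
    (hρ : ∀ s ∈ I, HasDerivAt ρ (j s * ρ₁ s) s)
    (hf0 : ∀ s ∈ I, f s ≠ 0) (hj : ∀ s ∈ I, j s ≠ 0) (hb0 : ∀ s ∈ I, b s ≠ 0)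
    (hρ0 : ∀ s ∈ I, ρ s ≠ 0)
    (hab : ∀ s ∈ I, σ * a s ^ 2 + τ * b s ^ 2 = η)
    (h₁ : ∀ s ∈ I, η * (-(σ * τ) * a s ^ 2 * ρ s + a s * b s * ρ₁ s + ρ s * b s ^ 2) * b s
      - σ * f s = -l * f s * b s ^ 2)
    (h₂ : ∀ s ∈ I, η * (-2 * (σ * τ) * ρ s * a s + b s * ρ₁ s) = -μ * g s) :
    (l = 0 ∧ ∃ k, k ≠ 0 ∧ ∀ s ∈ I, f s * b s = k ∧ ρ s * b s = σ * τ * f s) ∨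
    (l ≠ 0 ∧ ∃ c, c ≠ 0 ∧ ∀ s ∈ I, f s = -(σ * τ) * c * b s ∧ g s = c * a s) := by
  -- `ρ` and `f / b` are, up to sign, the principal radii along meridians and parallels. `R` is
  -- their sum up to sign and `R₁` its angular derivative.
  obtain ⟨R, hR⟩ : ∃ R : ℝ → ℝ, R = fun s => ρ s - σ * τ * f s / b s := ⟨_, rfl⟩
  obtain ⟨R₁, hR₁⟩ : ∃ R₁ : ℝ → ℝ, R₁ = fun s =>
    ρ₁ s - σ * τ * ρ s * a s / b s - f s * a s / b s ^ 2 := ⟨_, rfl⟩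
  have hς : (σ * τ) ^ 2 = 1 := by rw [mul_pow, hσ, hτ, one_mul]
  have hη0 : η ≠ 0 := fun h => by simp [h] at hη
  have hσ0 : σ ≠ 0 := fun h => by simp [h] at hσ
  have hτ0 : τ ≠ 0 := fun h => by simp [h] at hτ
  have hRd : ∀ s ∈ I, HasDerivAt R (j s * R₁ s) s := fun s hs => by
    have h0 := hb0 s hs
    rw [hR]
    refine ((hρ s hs).sub (((hf s hs).const_mul (σ * τ)).div (hb s hs) h0)).congr_deriv ?_
    rw [hR₁]
    field_simp
    grind
  have hfR : ∀ s ∈ I, f s = σ * τ * b s * (ρ s - R s) := fun s hs => by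
    have h0 := hb0 s hs
    rw [hR]
    field_simp
    grind
  have hR₁' : ∀ s ∈ I, b s * R₁ s = b s * ρ₁ s - σ * τ * a s * (2 * ρ s - R s) := fun s hs => by
    have h0 := hb0 s hs
    rw [hR₁]
    simp only []
    rw [hfR s hs]
    field_simp
    ring
  have e1 : ∀ s ∈ I, a s * R₁ s + R s * b s = -η * l * f s := fun s hs => by
    have h0 := hb0 s hs
    refine mul_right_cancel₀ h0 (mul_right_cancel₀ h0 ?_)
    have h3 := hR₁' s hs
    have h4 := h₁ s hs
    have h5 := hab s hs
    have h6 := hfR s hs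
    have h7 : R s * b s = ρ s * b s - σ * τ * f s := by
      rw [h6]; linear_combination b s * (ρ s - R s) * hς
    linear_combination a s * b s * h3 + (b s ^ 2 + σ * τ * a s ^ 2) * h7 + η * h4
      - (-(σ * τ) * a s ^ 2 * ρ s + a s * b s * ρ₁ s + ρ s * b s ^ 2) * b s * hη
      - f s * σ * h5 - f s * a s ^ 2 * (hς - hσ)
  have e2 : ∀ s ∈ I, b s * R₁ s - σ * τ * R s * a s = -η * μ * g s := fun s hs => by
    linear_combination hR₁' s hs + η * h₂ s hs
      - (-2 * (σ * τ) * ρ s * a s + b s * ρ₁ s) * hη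
  -- `e1` and `e2` are linear in `R` and `R₁` with determinant `±η`, by `hab`; `e3` and `e4` are the
  -- solution.
  have e3 : ∀ s ∈ I, R₁ s = -(σ * l * a s * f s + τ * μ * b s * g s) := fun s hs => by
    have h5 := hab s hs
    have : η * R₁ s = -η * (σ * l * a s * f s + τ * μ * b s * g s) := by
      linear_combination σ * a s * e1 s hs + τ * b s * e2 s hs - R₁ s * h5
        + σ * R s * a s * b s * hτ
    exact mul_left_cancel₀ hη0 (by linear_combination this)
  have e4 : ∀ s ∈ I, R s = -τ * (l * b s * f s - μ * a s * g s) := fun s hs => by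
    have h5 := hab s hs
    have : η * R s = -η * τ * (l * b s * f s - μ * a s * g s) := by
      linear_combination τ * b s * e1 s hs - τ * a s * e2 s hs - R s * h5
        - σ * R s * a s ^ 2 * hτ
    exact mul_left_cancel₀ hη0 (by linear_combination this)
  -- The derivative of `e4` is `-R₁ + 2 δ ρ a b` once `e3` is inserted; hence `e5`.
  obtain ⟨δ, hδ⟩ : ∃ δ, δ = -τ * (l - μ) / 2 := ⟨_, rfl⟩
  have e5 : ∀ s ∈ I, R₁ s = δ * ρ s * a s * b s := fun s hs => by
    have h5 := derivs_eq_of_eqOn hI e4 hs (hRd s hs)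
      ((((((hb s hs).const_mul l).mul (hf s hs))).sub
        (((ha s hs).const_mul μ).mul (hg s hs))).const_mul (-τ))
    have h6 : R₁ s = -τ * (l * (-(σ * τ) * a s * f s + b s * ρ s * a s)
        - μ * (b s * g s + a s * ρ s * b s)) := by
      refine mul_left_cancel₀ (hj s hs) (h5.trans ?_)
      ring
    rw [hδ]
    linear_combination (h6 + e3 s hs + σ * l * a s * f s * hτ) / 2
  obtain ⟨Λ, hΛ⟩ : ∃ Λ, Λ = η * (σ * τ) * l := ⟨_, rfl⟩
  have e6 : ∀ s ∈ I, (1 - Λ) * R s = -ρ s * (Λ + δ * a s ^ 2) := fun s hs => by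
    refine mul_left_cancel₀ (hb0 s hs) ?_
    rw [hΛ]
    linear_combination e1 s hs - a s * e5 s hs - η * l * hfR s hs
  have hba : ∀ s ∈ I, b s ^ 2 = τ * η - σ * τ * a s ^ 2 := fun s hs => by
    linear_combination τ * hab s hs - b s ^ 2 * hτ
  obtain ⟨s₁, hs₁, ha₁⟩ : ∃ s₁ ∈ I, a s₁ ≠ 0 := by
    by_cases h : a s₀ = 0
    · simpa [h] using exists_ne_of_hasDerivAt hI hs₀ (ha s₀ hs₀) (mul_ne_zero (hj s₀ hs₀) (hb0 s₀ hs₀))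
    · exact ⟨s₀, hs₀, h⟩
  by_cases hδ0 : δ = 0
  · have hRc := const_of_hasDerivAt_zero hI hc
      (fun s hs => (hRd s hs).congr_deriv (by rw [e5 s hs, hδ0]; ring)) hs₀
    by_cases hl : l = 0
    · left
      have hΛ0 : Λ = 0 := by rw [hΛ, hl, mul_zero]
      have hR0 : ∀ s ∈ I, ρ s * b s = σ * τ * f s := fun s hs => by
        have h := e6 s hs
        rw [hΛ0, hδ0] at h
        have h' : R s = 0 := by linear_combination h
        rw [hfR s hs, h']
        linear_combination -b s * ρ s * hς
      have hk := const_of_hasDerivAt_zero (F := fun s => f s * b s) hI hc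
        (fun s hs => ((hf s hs).mul (hb s hs)).congr_deriv (by
          linear_combination j s * a s * hR0 s hs)) hs₀
      exact ⟨hl, f s₀ * b s₀, mul_ne_zero (hf0 s₀ hs₀) (hb0 s₀ hs₀),
        fun s hs => ⟨hk s hs, hR0 s hs⟩⟩
    · right
      have hΛ0 : Λ ≠ 0 := by
        rw [hΛ]; exact mul_ne_zero (mul_ne_zero hη0 (mul_ne_zero hσ0 hτ0)) hl
      have hρc : ∀ s ∈ I, ρ s = ρ s₀ := fun s hs => by
        refine mul_left_cancel₀ hΛ0 ?_
        have h1 := e6 s hs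
        have h2 := e6 s₀ hs₀
        rw [hδ0] at h1 h2
        rw [hRc s hs] at h1
        linear_combination h1 - h2
      -- `R` and `ρ` are constant, so `hR₁'` reduces to `a (2 ρ - R) = 0`, used at a point with `a ≠
      -- 0`. Both radii then agree.
      have hc2 : R s₀ = 2 * ρ s₀ := by
        have h1 := derivs_eq_of_eqOn hI hρc hs₁ (hρ s₁ hs₁) (hasDerivAt_const _ _)
        have h2 := hR₁' s₁ hs₁
        have h3 : ρ₁ s₁ = 0 := (mul_eq_zero.1 h1).resolve_left (hj s₁ hs₁)
        rw [e5 s₁ hs₁, hδ0, h3, hρc s₁ hs₁, hRc s₁ hs₁] at h2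
        have h4 : σ * τ * a s₁ * (2 * ρ s₀ - R s₀) = 0 := by linear_combination h2
        have h5 := (mul_eq_zero.1 h4).resolve_left (mul_ne_zero (mul_ne_zero hσ0 hτ0) ha₁)
        linear_combination -h5
      have hΛ2 : Λ = 2 := by
        have h1 := e6 s₀ hs₀
        rw [hδ0, hc2] at h1
        exact mul_left_cancel₀ (hρ0 s₀ hs₀) (by linear_combination -h1)
      refine ⟨hl, ρ s₀, hρ0 s₀ hs₀, fun s hs => ⟨?_, ?_⟩⟩
      · rw [hfR s hs, hρc s hs, hRc s hs, hc2]; ring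
      · have h1 := e2 s hs
        have hμ : l = μ := by
          have : τ * (l - μ) = 0 := by rw [hδ] at hδ0; linear_combination -2 * hδ0
          linear_combination (mul_eq_zero.1 this).resolve_left hτ0
        rw [e5 s hs, hδ0, hRc s hs, hc2, ← hμ] at h1
        have h2 : η * (σ * τ) * l = 2 := hΛ ▸ hΛ2
        have h3 : σ * τ * (ρ s₀ * a s) * (σ * τ) = g s := by
          linear_combination -(σ * τ) / 2 * h1 + g s / 2 * h2
        linear_combination -h3 + ρ s₀ * a s * hς
  · exfalso
    -- The variable of the polynomial is `a ^ 2`, whose derivative `2 a j b` vanishes with `a`.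
    have hJ : IsOpen (I ∩ {s | a s ≠ 0}) := by
      have hcont : ContinuousOn a I := fun s hs => (ha s hs).continuousAt.continuousWithinAt
      exact hcont.isOpen_inter_preimage hI isOpen_ne
    have key := quadratic_coeffs_eq_zero (s₀ := s₁) hJ (u := fun s => a s ^ 2)
      (u' := fun s => 2 * a s * (j s * b s))
      -- Coefficients of `h5` below, after `b ^ 2 = τ η - σ τ a ^ 2`. That identity is the
      -- derivative of `e6` with `R`, `R₁`, `ρ₁` eliminated and the factor `ρ a` removed.
      (A := (1 - Λ) ^ 2 * δ * (τ * η) + Λ * ((1 - Λ) * δ * (τ * η) + 2 * (σ * τ) * (1 - Λ)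
        + σ * τ * Λ) + 2 * (1 - Λ) * δ * (τ * η))
      (B := -(1 - Λ) ^ 2 * δ * (σ * τ) + δ * ((1 - Λ) * δ * (τ * η) + 2 * (σ * τ) * (1 - Λ)
        + σ * τ * Λ) + Λ * (-(1 - Λ) * δ * (σ * τ) + σ * τ * δ) - 2 * (1 - Λ) * δ * (σ * τ))
      (K := σ * τ * δ ^ 2 * Λ)
      ⟨hs₁, ha₁⟩ (fun s hs => ((ha s hs.1).pow 2).congr_deriv (by push_cast; ring))
      (fun s hs => mul_ne_zero (mul_ne_zero two_ne_zero hs.2)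
        (mul_ne_zero (hj s hs.1) (hb0 s hs.1))) (fun s hs => by
        obtain ⟨hs, has⟩ := hs
        have h1 := derivs_eq_of_eqOn hI e6 hs ((hRd s hs).const_mul (1 - Λ))
          ((hρ s hs).neg.mul ((((ha s hs).pow 2).const_mul δ).const_add Λ))
        have h2 : (1 - Λ) * R₁ s = -ρ₁ s * (Λ + δ * a s ^ 2) - 2 * ρ s * δ * a s * b s := by
          refine mul_left_cancel₀ (hj s hs) ?_
          push_cast at h1
          simp only [Pi.neg_apply, Pi.pow_apply] at h1
          linear_combination h1
        have h3 := hR₁' s hs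
        rw [e5 s hs] at h2 h3
        refine mul_left_cancel₀ (mul_ne_zero (hρ0 s hs) has) ?_
        have h4 := hba s hs
        have h6 := e6 s hs
        have h5 : ρ s * a s * ((1 - Λ) ^ 2 * δ * b s ^ 2 + (Λ + δ * a s ^ 2) * ((1 - Λ) * δ * b s ^ 2
            + 2 * (σ * τ) * (1 - Λ) + σ * τ * (Λ + δ * a s ^ 2)) + 2 * (1 - Λ) * δ * b s ^ 2) = 0 := by
          linear_combination (1 - Λ) * b s * h2 + (1 - Λ) * (Λ + δ * a s ^ 2) * h3
            + (Λ + δ * a s ^ 2) * σ * τ * a s * h6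
        rw [h4] at h5
        linear_combination h5)
    obtain ⟨hA, -, hK⟩ := key
    have hΛ0 : Λ = 0 := by simpa [hσ0, hτ0, hδ0] using hK
    -- At `Λ = 0` the constant coefficient is `3 δ τ η`, which is nonzero.
    rw [hΛ0] at hA
    have : 3 * δ * (τ * η) = 0 := by linear_combination hA
    simp [hδ0, hτ0, hη0] at this

/-- The scheme of `profile_nonnull` with `R = ρ + p / a`. The off-diagonal entry `ν` now plays the
role of `δ`, and `u = ν a ^ 2 / 4` that of the polynomial variable. -/
theorem profile_null {I : Set ℝ} (hI : IsOpen I) (hc : IsPreconnected I) {s₀ : ℝ} (hs₀ : s₀ ∈ I)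
    {p r a b j ρ ρ₁ : ℝ → ℝ} {η l ν x z : ℝ} (hη : η ^ 2 = 1)
    (hp : ∀ s ∈ I, HasDerivAt p (j s * ρ s * a s) s)
    (hr : ∀ s ∈ I, HasDerivAt r (j s * ρ s * b s) s)
    (ha : ∀ s ∈ I, HasDerivAt a (j s * a s) s)
    (hρ : ∀ s ∈ I, HasDerivAt ρ (j s * ρ₁ s) s)
    (hp0 : ∀ s ∈ I, p s ≠ 0) (hj : ∀ s ∈ I, j s ≠ 0) (hρ0 : ∀ s ∈ I, ρ s ≠ 0)
    (hab : ∀ s ∈ I, a s * b s = -η)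
    (h₁ : ∀ s ∈ I, -η * (2 * a s * ρ s + a s * ρ₁ s) = l * p s)
    (h₂ : ∀ s ∈ I, ρ₁ s - 2 * p s / a s = a s * (l * (r s + z) + ν * (p s + x))) :
    (l = 0 ∧ ∃ k, k ≠ 0 ∧ ∀ s ∈ I, p s * a s = k ∧ ρ s * a s = -p s) ∨
    (l ≠ 0 ∧ ∃ c, c ≠ 0 ∧ ∀ s ∈ I, p s = c * a s ∧ r s + z = -c * b s) := by
  have hη0 : η ≠ 0 := fun h => by simp [h] at hη
  have ha0 : ∀ s ∈ I, a s ≠ 0 := fun s hs h => hη0 (by simpa [h] using (hab s hs).symm)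
  obtain ⟨R, hR⟩ : ∃ R : ℝ → ℝ, R = fun s => ρ s + p s / a s := ⟨_, rfl⟩
  obtain ⟨R₁, hR₁⟩ : ∃ R₁ : ℝ → ℝ, R₁ = fun s => ρ₁ s + ρ s - p s / a s := ⟨_, rfl⟩
  have hRd : ∀ s ∈ I, HasDerivAt R (j s * R₁ s) s := fun s hs => by
    have h0 := ha0 s hs
    rw [hR]
    refine ((hρ s hs).add ((hp s hs).div (ha s hs) h0)).congr_deriv ?_
    rw [hR₁]
    field_simp
    ring
  have hpR : ∀ s ∈ I, p s = a s * (R s - ρ s) := fun s hs => by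
    have h0 := ha0 s hs
    rw [hR]
    field_simp
    ring
  have hR₁' : ∀ s ∈ I, R₁ s = ρ₁ s + 2 * ρ s - R s := fun s hs => by
    rw [hR₁, hR]; ring
  have e1 : ∀ s ∈ I, R₁ s + R s = -η * l * (R s - ρ s) := fun s hs => by
    refine mul_left_cancel₀ (ha0 s hs) ?_
    linear_combination a s * hR₁' s hs - η * h₁ s hs - (2 * a s * ρ s + a s * ρ₁ s) * hη
      - η * l * hpR s hs
  have e2 : ∀ s ∈ I, R₁ s - R s = a s * (l * (r s + z) + ν * (p s + x)) := fun s hs => by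
    rw [← h₂ s hs, hR₁, hR]; ring
  have e3 : ∀ s ∈ I, 2 * R s = -η * l * (R s - ρ s) - a s * (l * (r s + z) + ν * (p s + x)) :=
    fun s hs => by linear_combination e1 s hs - e2 s hs
  -- The derivative of `e3` brings back the right side of `e2` and, through `hab`, a term in `l ρ`;
  -- `e1` and `hR₁'` cancel everything but the `ν` term.
  have e4 : ∀ s ∈ I, R₁ s = -(ν / 4) * ρ s * a s ^ 2 := fun s hs => by
    have h1 := derivs_eq_of_eqOn hI e3 hs ((hRd s hs).const_mul 2)
      ((((hRd s hs).sub (hρ s hs)).const_mul (-η * l)).sub ((ha s hs).mul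
        ((((hr s hs).add_const z).const_mul l).add (((hp s hs).add_const x).const_mul ν))))
    have h2 : 2 * R₁ s = -η * l * (R₁ s - ρ₁ s) - (a s * (l * (r s + z) + ν * (p s + x))
        + a s * (l * (ρ s * b s) + ν * (ρ s * a s))) := by
      refine mul_left_cancel₀ (hj s hs) (Eq.trans ?_ (h1.trans ?_)) <;> ring
    have h3 := hR₁' s hs
    linear_combination (h2 + e2 s hs - l * ρ s * hab s hs - η * l * h3 + e1 s hs) / 4
  obtain ⟨Λ, hΛ⟩ : ∃ Λ, Λ = η * l := ⟨_, rfl⟩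
  obtain ⟨u, hu⟩ : ∃ u : ℝ → ℝ, u = fun s => ν / 4 * a s ^ 2 := ⟨_, rfl⟩
  have hud : ∀ s ∈ I, HasDerivAt u (2 * j s * u s) s := fun s hs => by
    rw [hu]
    exact (((ha s hs).pow 2).const_mul (ν / 4)).congr_deriv (by push_cast; ring)
  have e5 : ∀ s ∈ I, R₁ s = -ρ s * u s := fun s hs => by rw [e4 s hs, hu]; ring
  have e6 : ∀ s ∈ I, (1 + Λ) * R s = ρ s * (Λ + u s) := fun s hs => by
    rw [hΛ]; linear_combination e1 s hs - e5 s hs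
  by_cases hν : ν = 0
  · have hu0 : ∀ s, u s = 0 := fun s => by rw [hu, hν]; simp
    have hRc := const_of_hasDerivAt_zero hI hc
      (fun s hs => (hRd s hs).congr_deriv (by rw [e5 s hs, hu0]; ring)) hs₀
    by_cases hl : l = 0
    · left
      have hR0 : ∀ s ∈ I, ρ s * a s = -p s := fun s hs => by
        have h := e6 s hs
        rw [hΛ, hl, hu0] at h
        linear_combination hpR s hs + a s * h
      have hk := const_of_hasDerivAt_zero (F := fun s => p s * a s) hI hc
        (fun s hs => ((hp s hs).mul (ha s hs)).congr_deriv (by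
          linear_combination j s * a s * hR0 s hs)) hs₀
      exact ⟨hl, p s₀ * a s₀, mul_ne_zero (hp0 s₀ hs₀) (ha0 s₀ hs₀),
        fun s hs => ⟨hk s hs, hR0 s hs⟩⟩
    · right
      have hΛ0 : Λ ≠ 0 := by rw [hΛ]; exact mul_ne_zero hη0 hl
      have hρc : ∀ s ∈ I, ρ s = ρ s₀ := fun s hs => by
        refine mul_left_cancel₀ hΛ0 ?_
        have h1 := e6 s hs
        have h2 := e6 s₀ hs₀
        rw [hu0] at h1 h2
        rw [hRc s hs] at h1
        linear_combination h2 - h1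
      have hρ₁ : ∀ s ∈ I, ρ₁ s = 0 := fun s hs =>
        (mul_eq_zero.1 (derivs_eq_of_eqOn hI hρc hs (hρ s hs) (hasDerivAt_const _ _))).resolve_left
          (hj s hs)
      have hc2 : R s₀ = 2 * ρ s₀ := by
        have h2 := hR₁' s₀ hs₀
        rw [e5 s₀ hs₀, hρ₁ s₀ hs₀, hu0] at h2
        linear_combination h2
      have hΛ2 : Λ = -2 := by
        have h1 := e6 s₀ hs₀
        rw [hu0, hc2] at h1
        exact mul_left_cancel₀ (hρ0 s₀ hs₀) (by linear_combination h1)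
      have hpa : ∀ s ∈ I, p s = ρ s₀ * a s := fun s hs => by
        rw [hpR s hs, hρc s hs, hRc s hs, hc2]; ring
      refine ⟨hl, ρ s₀, hρ0 s₀ hs₀, fun s hs => ⟨hpa s hs, ?_⟩⟩
      have h1 := e2 s hs
      rw [e5 s hs, hu0, hRc s hs, hc2, hν] at h1
      have h2 : η * l = -2 := hΛ ▸ hΛ2
      refine mul_left_cancel₀ (ha0 s hs) ?_
      linear_combination (η / 2) * h1 + a s * (r s + z) / 2 * h2 + ρ s₀ * hab s hs
  · exfalso
    have key := quadratic_coeffs_eq_zero (s₀ := s₀) hI (u := u) (u' := fun s => 2 * j s * u s)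
      (A := -(Λ * (2 + Λ))) (B := (1 + Λ) ^ 2 - (2 + Λ) - Λ ^ 2 + 2 * (1 + Λ)) (K := -Λ)
      hs₀ hud (fun s hs => by
        rw [hu]
        exact mul_ne_zero (mul_ne_zero two_ne_zero (hj s hs))
          (mul_ne_zero (div_ne_zero hν four_ne_zero) (pow_ne_zero 2 (ha0 s hs))))
      (fun s hs => by
        have h1 := derivs_eq_of_eqOn hI e6 hs ((hRd s hs).const_mul (1 + Λ))
          ((hρ s hs).mul ((hud s hs).const_add Λ))
        have h2 : (1 + Λ) * R₁ s = ρ₁ s * (Λ + u s) + 2 * ρ s * u s :=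
          mul_left_cancel₀ (hj s hs) (by linear_combination h1)
        have h3 := hR₁' s hs
        rw [e5 s hs] at h2 h3
        refine mul_left_cancel₀ (hρ0 s hs) ?_
        linear_combination -(1 + Λ) * h2 + (1 + Λ) * (Λ + u s) * h3 - (Λ + u s) * e6 s hs)
    obtain ⟨-, hB, hK⟩ := key
    have hΛ0 : Λ = 0 := by linear_combination -hK
    -- At `Λ = 0` the linear coefficient equals `1`.
    rw [hΛ0] at hB
    norm_num at hB

/-! ### Profile curves of minimal surfaces of revolution -/

theorem exists_cos_sin_eq {x y : ℝ} (h : x ^ 2 + y ^ 2 = 1) :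
    ∃ θ, x = Real.cos θ ∧ y = Real.sin θ := by
  have hn : ‖(⟨x, y⟩ : ℂ)‖ = 1 := by
    rw [Complex.norm_def, Complex.normSq_mk, ← sq, ← sq, h, Real.sqrt_one]
  refine ⟨Complex.arg ⟨x, y⟩, ?_, ?_⟩
  · simpa [hn] using (Complex.norm_mul_cos_arg ⟨x, y⟩).symm
  · simpa [hn] using (Complex.norm_mul_sin_arg ⟨x, y⟩).symm

theorem exists_cosh_sinh_eq {x y : ℝ} (hx : 0 < x) (h : x ^ 2 - y ^ 2 = 1) :
    ∃ θ, x = Real.cosh θ ∧ y = Real.sinh θ := by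
  refine ⟨Real.arsinh y, ?_, (Real.sinh_arsinh y).symm⟩
  rw [Real.cosh_arsinh, show 1 + y ^ 2 = x ^ 2 by linear_combination -h, Real.sqrt_sq hx.le]

section Solutions

variable {I : Set ℝ} {f g g' m : ℝ → ℝ} {s₀ k ε : ℝ}

/-- With `m = df/dg`, the quantities `(f ± k m) exp (∓ g / k)` are constant, with values `P`, `Q`
and `P Q = ε k ^ 2`. Thus `2 f = P exp (g / k) + Q exp (-g / k)`, and `|P| / k` is absorbed into the
shift `d`; squaring `f` removes the sign of `P`. -/
theorem exists_eq_exp (hI : IsOpen I) (hc : IsPreconnected I) (hs₀ : s₀ ∈ I) (hk : 0 < k)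
    (hε : ε ^ 2 = 1)
    (hf : ∀ s ∈ I, HasDerivAt f (g' s * m s) s) (hg : ∀ s ∈ I, HasDerivAt g (g' s) s)
    (hm : ∀ s ∈ I, HasDerivAt m (g' s * f s / k ^ 2) s)
    (h : ∀ s ∈ I, f s ^ 2 - k ^ 2 * m s ^ 2 = ε * k ^ 2) :
    ∃ d, ∀ s ∈ I, 4 * f s ^ 2
      = k ^ 2 * (Real.exp ((g s + d) / k) ^ 2 + 2 * ε + Real.exp (-((g s + d) / k)) ^ 2) := by
  have hE : ∀ s ∈ I, HasDerivAt (fun s => Real.exp (g s / k))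
      (Real.exp (g s / k) * (g' s / k)) s := fun s hs => ((hg s hs).div_const k).exp
  have hE' : ∀ s ∈ I, HasDerivAt (fun s => Real.exp (-(g s / k)))
      (Real.exp (-(g s / k)) * -(g' s / k)) s := fun s hs => ((hg s hs).div_const k).neg.exp
  have h1 := const_of_hasDerivAt_zero hI hc (fun s hs =>
    (((hf s hs).add ((hm s hs).const_mul k)).mul (hE' s hs)).congr_deriv
      (g' := 0) (by simp only [Pi.add_apply]; field_simp; ring)) hs₀
  have h2 := const_of_hasDerivAt_zero hI hc (fun s hs =>
    (((hf s hs).sub ((hm s hs).const_mul k)).mul (hE s hs)).congr_deriv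
      (g' := 0) (by simp only [Pi.sub_apply]; field_simp; ring)) hs₀
  simp only [Pi.mul_apply, Pi.add_apply, Pi.sub_apply] at h1 h2
  set P := (f s₀ + k * m s₀) * Real.exp (-(g s₀ / k)) with hP
  set Q := (f s₀ - k * m s₀) * Real.exp (g s₀ / k) with hQ
  have hexp : ∀ y, Real.exp (-y) * Real.exp y = 1 := fun y => by rw [← Real.exp_add]; simp
  have hPQ : P * Q = ε * k ^ 2 := by
    rw [hP, hQ]
    linear_combination (f s₀ ^ 2 - k ^ 2 * m s₀ ^ 2) * hexp (g s₀ / k) + h s₀ hs₀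
  have hε0 : ε ≠ 0 := fun h => by simp [h] at hε
  have hP0 : P ≠ 0 := fun h0 => by
    rw [h0, zero_mul] at hPQ
    exact mul_ne_zero hε0 (pow_ne_zero 2 hk.ne') hPQ.symm
  have hd : Real.exp (Real.log (P / k)) ^ 2 = P ^ 2 / k ^ 2 := by
    rw [Real.exp_log_eq_abs (div_ne_zero hP0 hk.ne'), sq_abs, div_pow]
  refine ⟨k * Real.log (P / k), fun s hs => ?_⟩
  have e1 : (g s + k * Real.log (P / k)) / k = g s / k + Real.log (P / k) := by
    field_simp
  have h3 := h1 s hs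
  have h4 := h2 s hs
  have h5 := hexp (g s / k)
  rw [e1, neg_add, Real.exp_add, Real.exp_add, Real.exp_neg (Real.log _), mul_pow, mul_pow,
    inv_pow, hd]
  have h6 : f s + k * m s = P * Real.exp (g s / k) := by
    rw [← h3]; linear_combination -(f s + k * m s) * h5
  have h7 : f s - k * m s = Q * Real.exp (-(g s / k)) := by
    rw [← h4]; linear_combination -(f s - k * m s) * h5
  have h8 : 2 * f s = P * Real.exp (g s / k) + Q * Real.exp (-(g s / k)) := by
    linear_combination h6 + h7
  have h9 : k ^ 2 * (P ^ 2 / k ^ 2)⁻¹ = Q ^ 2 := by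
    field_simp
    linear_combination -(P * Q + ε * k ^ 2) * hPQ - k ^ 4 * hε
  have h10 : k ^ 2 * (P ^ 2 / k ^ 2) = P ^ 2 := by field_simp
  have h11 : 4 * f s ^ 2 = (P * Real.exp (g s / k) + Q * Real.exp (-(g s / k))) ^ 2 := by
    rw [← h8]; ring
  rw [h11]
  linear_combination -Real.exp (g s / k) ^ 2 * h10 - Real.exp (-(g s / k)) ^ 2 * h9
    + 2 * P * Q * h5 + 2 * hPQ

theorem exists_eq_cosh (hI : IsOpen I) (hc : IsPreconnected I) (hs₀ : s₀ ∈ I) (hk : 0 < k)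
    (hf : ∀ s ∈ I, HasDerivAt f (g' s * m s) s) (hg : ∀ s ∈ I, HasDerivAt g (g' s) s)
    (hm : ∀ s ∈ I, HasDerivAt m (g' s * f s / k ^ 2) s)
    (h : ∀ s ∈ I, f s ^ 2 - k ^ 2 * m s ^ 2 = k ^ 2) :
    ∃ d, ∀ s ∈ I, f s ^ 2 = k ^ 2 * Real.cosh ((g s + d) / k) ^ 2 := by
  obtain ⟨d, hd⟩ := exists_eq_exp hI hc hs₀ hk (ε := 1) (by norm_num) hf hg hm
    (fun s hs => by rw [h s hs, one_mul])
  refine ⟨d, fun s hs => ?_⟩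
  have hexp : Real.exp (-((g s + d) / k)) * Real.exp ((g s + d) / k) = 1 := by
    rw [← Real.exp_add]; simp
  rw [Real.cosh_eq]
  linear_combination hd s hs / 4 - k ^ 2 / 2 * hexp

theorem exists_eq_sinh (hI : IsOpen I) (hc : IsPreconnected I) (hs₀ : s₀ ∈ I) (hk : 0 < k)
    (hf : ∀ s ∈ I, HasDerivAt f (g' s * m s) s) (hg : ∀ s ∈ I, HasDerivAt g (g' s) s)
    (hm : ∀ s ∈ I, HasDerivAt m (g' s * f s / k ^ 2) s)
    (h : ∀ s ∈ I, f s ^ 2 - k ^ 2 * m s ^ 2 = -k ^ 2) :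
    ∃ d, ∀ s ∈ I, f s ^ 2 = k ^ 2 * Real.sinh ((g s + d) / k) ^ 2 := by
  obtain ⟨d, hd⟩ := exists_eq_exp hI hc hs₀ hk (ε := -1) (by norm_num) hf hg hm
    (fun s hs => by rw [h s hs]; ring)
  refine ⟨d, fun s hs => ?_⟩
  have hexp : Real.exp (-((g s + d) / k)) * Real.exp ((g s + d) / k) = 1 := by
    rw [← Real.exp_add]; simp
  rw [Real.sinh_eq]
  linear_combination hd s hs / 4 + k ^ 2 / 2 * hexp

/-- Rotating `(f, k m)` through the angle `g / k` gives a constant vector of length `k`; its polar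
angle supplies the shift. -/
theorem exists_eq_sin (hI : IsOpen I) (hc : IsPreconnected I) (hs₀ : s₀ ∈ I) (hk : 0 < k)
    (hf : ∀ s ∈ I, HasDerivAt f (g' s * m s) s) (hg : ∀ s ∈ I, HasDerivAt g (g' s) s)
    (hm : ∀ s ∈ I, HasDerivAt m (-(g' s * f s / k ^ 2)) s)
    (h : ∀ s ∈ I, f s ^ 2 + k ^ 2 * m s ^ 2 = k ^ 2) :
    ∃ d, ∀ s ∈ I, f s ^ 2 = k ^ 2 * Real.sin ((g s + d) / k) ^ 2 := by
  have hC : ∀ s ∈ I, HasDerivAt (fun s => Real.cos (g s / k))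
      (-Real.sin (g s / k) * (g' s / k)) s := fun s hs => ((hg s hs).div_const k).cos
  have hS : ∀ s ∈ I, HasDerivAt (fun s => Real.sin (g s / k))
      (Real.cos (g s / k) * (g' s / k)) s := fun s hs => ((hg s hs).div_const k).sin
  have h1 := const_of_hasDerivAt_zero hI hc (fun s hs =>
    (((hf s hs).mul (hC s hs)).sub (((hm s hs).const_mul k).mul (hS s hs))).congr_deriv
      (g' := 0) (by field_simp; ring)) hs₀
  have h2 := const_of_hasDerivAt_zero hI hc (fun s hs =>
    (((hf s hs).mul (hS s hs)).add (((hm s hs).const_mul k).mul (hC s hs))).congr_deriv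
      (g' := 0) (by field_simp; ring)) hs₀
  simp only [Pi.mul_apply, Pi.add_apply, Pi.sub_apply] at h1 h2
  set P := f s₀ * Real.cos (g s₀ / k) - k * m s₀ * Real.sin (g s₀ / k) with hP
  set Q := f s₀ * Real.sin (g s₀ / k) + k * m s₀ * Real.cos (g s₀ / k) with hQ
  obtain ⟨φ, hφ₁, hφ₂⟩ : ∃ φ, Q / k = Real.cos φ ∧ P / k = Real.sin φ := by
    apply exists_cos_sin_eq
    have h3 := h s₀ hs₀
    have h4 := Real.sin_sq_add_cos_sq (g s₀ / k)
    field_simp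
    rw [hP, hQ]
    linear_combination (f s₀ ^ 2 + k ^ 2 * m s₀ ^ 2) * h4 + h3
  refine ⟨k * φ, fun s hs => ?_⟩
  have e1 : (g s + k * φ) / k = g s / k + φ := by field_simp
  have h4 := Real.sin_sq_add_cos_sq (g s / k)
  have h5 : f s = k * Real.sin ((g s + k * φ) / k) := by
    rw [e1, Real.sin_add, ← hφ₁, ← hφ₂]
    field_simp
    linear_combination -f s * h4 + Real.cos (g s / k) * h1 s hs + Real.sin (g s / k) * h2 s hs
  rw [← mul_pow, ← h5]

end Solutions

/-! ### Unit tangents -/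

theorem exists_sign {I : Set ℝ} (hc : IsPreconnected I) {W : ℝ → ℝ} (hW : ContinuousOn W I)
    (h0 : ∀ s ∈ I, W s ≠ 0) : ∃ η : ℝ, η ^ 2 = 1 ∧ ∀ s ∈ I, 0 < η * W s := by
  by_cases h : ∀ s ∈ I, 0 < W s
  · exact ⟨1, by norm_num, fun s hs => by simpa using h s hs⟩
  · push Not at h
    obtain ⟨s₁, hs₁, h₁⟩ := h
    refine ⟨-1, by norm_num, fun s hs => ?_⟩
    by_contra h₂
    have h₃ : (0 : ℝ) ∈ Set.Icc (W s₁) (W s) := ⟨h₁, by linarith⟩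
    obtain ⟨t, ht, ht0⟩ := hc.intermediate_value hs₁ hs hW h₃
    exact h0 t ht ht0

theorem hasDerivAt_of_contDiffOn {I : Set ℝ} (hI : IsOpen I) {f : ℝ → ℝ}
    (hf : ContDiffOn ℝ ∞ f I) : ∀ s ∈ I, HasDerivAt f (deriv f s) s := fun _ hs =>
  ((hf.differentiableOn (by simp)).differentiableAt (hI.mem_nhds hs)).hasDerivAt

theorem contDiffOn_deriv {I : Set ℝ} (hI : IsOpen I) {f : ℝ → ℝ}
    (hf : ContDiffOn ℝ ∞ f I) : ContDiffOn ℝ ∞ (deriv f) I :=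
  hf.deriv_of_isOpen hI (by simp)

/-- The squared length of the velocity has a constant sign `η` on the connected `I`, so its
normalised root `V` is smooth. -/
theorem exists_unit_tangent {I : Set ℝ} (hI : IsOpen I) (hc : IsPreconnected I) {f g : ℝ → ℝ}
    (hf : ContDiffOn ℝ ∞ f I) (hg : ContDiffOn ℝ ∞ g I) {α β γ : ℝ}
    (hW : ∀ s ∈ I, α * deriv f s ^ 2 + 2 * β * deriv f s * deriv g s + γ * deriv g s ^ 2 ≠ 0) :
    ∃ (η : ℝ) (V a b : ℝ → ℝ), η ^ 2 = 1 ∧ ContDiffOn ℝ ∞ V I ∧ ContDiffOn ℝ ∞ a I ∧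
      ContDiffOn ℝ ∞ b I ∧ (∀ s ∈ I, 0 < V s) ∧ (∀ s ∈ I, HasDerivAt f (V s * a s) s) ∧
      (∀ s ∈ I, HasDerivAt g (V s * b s) s) ∧
      ∀ s ∈ I, α * a s ^ 2 + 2 * β * a s * b s + γ * b s ^ 2 = η := by
  have hf' := contDiffOn_deriv hI hf
  have hg' := contDiffOn_deriv hI hg
  have hWs : ContDiffOn ℝ ∞ (fun s => α * deriv f s ^ 2 + 2 * β * deriv f s * deriv g s
      + γ * deriv g s ^ 2) I :=
    ((contDiffOn_const.mul (hf'.pow 2)).add ((contDiffOn_const.mul hf').mul hg')).add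
      (contDiffOn_const.mul (hg'.pow 2))
  obtain ⟨η, hη, hpos⟩ := exists_sign hc hWs.continuousOn hW
  have hVs := (contDiffOn_const (c := η).mul hWs).sqrt fun s hs => (hpos s hs).ne'
  have hV0 := fun s hs => Real.sqrt_pos.2 (hpos s hs)
  refine ⟨η, _, fun s => deriv f s / _, fun s => deriv g s / _, hη, hVs,
    hf'.div hVs fun s hs => (hV0 s hs).ne', hg'.div hVs fun s hs => (hV0 s hs).ne', hV0,
    fun s hs => ?_, fun s hs => ?_, fun s hs => ?_⟩
  · exact (hasDerivAt_of_contDiffOn hI hf s hs).congr_deriv (mul_div_cancel₀ _ (hV0 s hs).ne').symm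
  · exact (hasDerivAt_of_contDiffOn hI hg s hs).congr_deriv (mul_div_cancel₀ _ (hV0 s hs).ne').symm
  · have h1 := Real.sq_sqrt (hpos s hs).le
    have h2 := (hV0 s hs).ne'
    simp only [] at h1 h2 ⊢
    set V := Real.sqrt (η * (α * deriv f s ^ 2 + 2 * β * deriv f s * deriv g s
      + γ * deriv g s ^ 2))
    field_simp
    linear_combination -η * h1 - (α * deriv f s ^ 2 + 2 * β * deriv f s * deriv g s
      + γ * deriv g s ^ 2) * hη

/-! ### From `Δ^{III} X = A X` to explicit profile curves -/

namespace RotationFrame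

variable {C D : ℝ → E31} {e : E31} {τ κ α β γ ε : ℝ} {I : Set ℝ} {X : ℝ → ℝ → E31} {v : E31}

/-- The hypothesis `Δ^{III} X = A X` in terms of the profile curve. -/
theorem laplaceIII_relation (F : RotationFrame C D e τ κ α β γ ε) (hI : IsOpen I)
    (hc : IsPreconnected I) {p r a b j m m₂ ρ Pa Pb : ℝ → ℝ} {s₀ t η : ℝ}
    (hs₀ : s₀ ^ 2 = 1) (ht : t ^ 2 = 1) (hη : η ^ 2 = 1)
    (hX : ∀ s ∈ I, ∀ θ, X s θ = p s • C θ + r s • e + v)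
    (hn : ∀ s ∈ I, ∀ θ, unitNormal X s θ = (s₀ * m s) • C θ + (s₀ * m₂ s) • e)
    (hm : ∀ s ∈ I, HasDerivAt m (t * j s * a s) s)
    (hm₂ : ∀ s ∈ I, HasDerivAt m₂ (t * j s * b s) s)
    (hab : ∀ s ∈ I, α * a s ^ 2 + 2 * β * a s * b s + γ * b s ^ 2 = η)
    (hp : ∀ s ∈ I, HasDerivAt p (j s * ρ s * a s) s)
    (hr : ∀ s ∈ I, HasDerivAt r (j s * ρ s * b s) s)
    (hjc : ContinuousOn j I) (hj : ∀ s ∈ I, j s ≠ 0) (hm0 : ∀ s ∈ I, m s ≠ 0)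
    (hPa : ∀ s ∈ I, HasDerivAt (fun s => m s * ρ s * a s) (Pa s) s)
    (hPb : ∀ s ∈ I, HasDerivAt (fun s => m s * ρ s * b s) (Pb s) s)
    {A : Matrix (Fin 3) (Fin 3) ℝ}
    (hA : ∀ s ∈ I, ∀ θ : ℝ, ∀ i : Fin 3,
      laplaceIII X (fun s θ => X s θ i) s θ = A.mulVec (X s θ) i) :
    ∀ s ∈ I, ∀ θ, (-(η * Pa s + ε * τ * j s * p s / m s) / (j s * m s)) • C θ
        + (-(η * Pb s + ε * κ * j s * p s / m s) / (j s * m s)) • e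
      = LinearMap.toContinuousLinearMap A.mulVecLin (p s • C θ + r s • e + v) := by
  intro s hs θ
  obtain ⟨ς, hς, hpos⟩ := exists_sign hc (W := fun s => j s * m s)
    (hjc.mul fun s hs => (hm s hs).continuousAt.continuousWithinAt)
    (fun s hs => mul_ne_zero (hj s hs) (hm0 s hs))
  have habs : ∀ s ∈ I, |j s * m s| = ς * (j s * m s) := fun s hs => by
    have h1 : |ς| = 1 := by rw [← abs_one, ← sq_eq_sq_iff_abs_eq_abs, hς]; norm_num
    rw [← abs_of_pos (hpos s hs), abs_mul ς, h1, one_mul]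
  ext i
  have h := F.laplaceIII_eq hI hη hς hX 
    (fun s hs θ => F.thirdForm_eq hI hs₀ ht hn hm hm₂ hab hs θ) hp hr hj hm0 habs
    hPa hPb hs θ i
  rw [hA s hs, hX s hs] at h
  simpa using h.symm

/-- Here `α = ⟨C, C⟩`, `τ = ⟨e, e⟩`, `η` is the causal sign of the profile and `χ` the orientation
sign. The products `α η` and `η τ` select the type of catenoid. -/
theorem nonnull_classification (F : RotationFrame C D e τ 0 α 0 τ (-(α * τ))) {χ : ℝ}
    (hα : α ^ 2 = 1) (hτ : τ ^ 2 = 1) (hχ : χ ^ 2 = 1)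
    (hCD : ∀ θ, cross (C θ) (D θ) = (-(α * τ) * χ) • e) (heD : ∀ θ, cross e (D θ) = χ • C θ)
    (hI : IsOpen I) (hc : IsConnected I) {f g : ℝ → ℝ} (hf : ContDiffOn ℝ ∞ f I)
    (hg : ContDiffOn ℝ ∞ g I) (hf0 : ∀ s ∈ I, 0 < f s)
    (hX : ∀ s ∈ I, ∀ θ, X s θ = f s • C θ + g s • e + v)
    (h₁ : ∀ s ∈ I, ∀ θ, (firstForm X s θ).det ≠ 0)
    (h₂ : ∀ s ∈ I, ∀ θ, (secondForm X s θ).det ≠ 0)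
    {x y z : ℝ} (hv : v = x • C 0 + y • D 0 + z • e)
    {A : Matrix (Fin 3) (Fin 3) ℝ}
    (hA : ∀ s ∈ I, ∀ θ : ℝ, ∀ i : Fin 3,
      laplaceIII X (fun s θ => X s θ i) s θ = A.mulVec (X s θ) i) :
    (∀ s ∈ I, deriv g s ≠ 0) ∧ ∃ η : ℝ, η ^ 2 = 1 ∧
      ((x = 0 ∧ y = 0 ∧ ∃ c, 0 < c ∧ ∀ s ∈ I,
          α * f s ^ 2 + τ * (g s + z) ^ 2 = α * τ * η * c ^ 2) ∨
        ∃ k, 0 < k ∧ ∃ d,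
          (α * η = 1 ∧ η * τ = 1 ∧ ∀ s ∈ I, f s ^ 2 = k ^ 2 * Real.cosh ((g s + d) / k) ^ 2) ∨
          (α * η = 1 ∧ η * τ = -1 ∧ ∀ s ∈ I, f s ^ 2 = k ^ 2 * Real.sinh ((g s + d) / k) ^ 2) ∨
          (α * η = -1 ∧ η * τ = 1 ∧ ∀ s ∈ I, f s ^ 2 = k ^ 2 * Real.sin ((g s + d) / k) ^ 2)) := by
  obtain ⟨⟨s₀, hs₀⟩, hc⟩ := hc
  have hτ0 : τ ≠ 0 := fun h => by simp [h] at hτ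
  have hfd := hasDerivAt_of_contDiffOn hI hf
  have hgd := hasDerivAt_of_contDiffOn hI hg
  obtain ⟨η, V, a, b, hη, hVs, has, hbs, hV0, hfV, hgV, hab⟩ :=
    exists_unit_tangent hI hc hf hg (α := α) (β := 0) (γ := τ) fun s hs h0 => by
      have h := h₁ s hs 0
      rw [F.firstForm_det hI hX hfd hgd hs, h0, zero_mul] at h
      exact h rfl
  have hab' : ∀ s ∈ I, α * a s ^ 2 + τ * b s ^ 2 = η := fun s hs => by rw [← hab s hs]; ring
  have hba : ∀ s ∈ I, b s ^ 2 + α * τ * a s ^ 2 = τ * η := fun s hs => by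
    linear_combination τ * hab' s hs - b s ^ 2 * hτ
  have had := hasDerivAt_of_contDiffOn hI has
  have hbd := hasDerivAt_of_contDiffOn hI hbs
  have hVd := hasDerivAt_of_contDiffOn hI hVs
  have hn : ∀ s ∈ I, ∀ θ, unitNormal X s θ = (χ * b s) • C θ + (χ * (-(α * τ) * a s)) • e :=
    fun s hs θ => by
      have hcr : cross (dS X s θ) (dθ X s θ)
          = (f s * V s) • ((χ * b s) • C θ + (χ * (-(α * τ) * a s)) • e) := by
        rw [dS_rotation hI hs (hfV s hs) (hgV s hs) hX,
          dθ_rotation (F.hasDerivAt_C θ) (hX s hs), cross_smul_right, cross_add_left,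
          cross_smul_left, cross_smul_left, hCD, heD]
        module
      have hfV0 := mul_pos (hf0 s hs) (hV0 s hs)
      have hnn : lorentz (cross (dS X s θ) (dθ X s θ)) (cross (dS X s θ) (dθ X s θ))
          = α * τ * η * (f s * V s) ^ 2 := by
        rw [hcr]
        simp only [lorentz_add_left, lorentz_smul_left, lorentz_add_right, lorentz_smul_right,
          F.CC, F.Ce, F.ee, F.eC]
        linear_combination (f s * V s) ^ 2 * α * τ * (hab' s hs) + (f s * V s) ^ 2 * (α * b s ^ 2
          + τ * (α * τ * a s) ^ 2) * hχ + (f s * V s) ^ 2 * (-α * b s ^ 2 * hτ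
          + τ * a s ^ 2 * α ^ 2 * hτ)
      have h3 : |α * τ * η| = 1 := by
        rw [← abs_one, ← sq_eq_sq_iff_abs_eq_abs, mul_pow, mul_pow, hα, hτ, hη]; norm_num
      rw [unitNormal, hnn, abs_mul, h3, one_mul, abs_of_nonneg (sq_nonneg _),
        Real.sqrt_sq hfV0.le, hcr, inv_smul_smul₀ hfV0.ne']
  have hII := fun s (hs : s ∈ I) => F.secondForm_det hI hX hfV hgV
    (fun s hs => (hVd s hs).mul (had s hs)) (fun s hs => (hVd s hs).mul (hbd s hs)) hs (hn s hs 0)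
  -- If `b = 0`, the normal has no `C` component and the second form loses its `θθ` entry; if `j =
  -- 0` below, the acceleration of the profile is tangential and the `ss` entry vanishes.
  have hb0 : ∀ s ∈ I, b s ≠ 0 := fun s hs h0 => by
    refine h₂ s hs 0 ?_
    rw [hII s hs, h0]; ring
  have hrel : ∀ s ∈ I, α * a s * deriv a s + τ * b s * deriv b s = 0 := fun s hs => by
    have h := derivs_eq_of_eqOn hI hab' hs ((((had s hs).pow 2).const_mul α).add
      (((hbd s hs).pow 2).const_mul τ)) (hasDerivAt_const s η)
    push_cast at h
    linear_combination h / 2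
  obtain ⟨j, hj⟩ : ∃ j : ℝ → ℝ, j = fun s => deriv a s / b s := ⟨_, rfl⟩
  have hjs : ContDiffOn ℝ ∞ j I := hj ▸ (contDiffOn_deriv hI has).div hbs hb0
  have haj : ∀ s ∈ I, HasDerivAt a (j s * b s) s := fun s hs =>
    (had s hs).congr_deriv (by rw [hj]; exact (div_mul_cancel₀ _ (hb0 s hs)).symm)
  have hbj : ∀ s ∈ I, HasDerivAt b (-(α * τ) * j s * a s) s := fun s hs =>
    (hbd s hs).congr_deriv (by
      refine mul_left_cancel₀ (hb0 s hs) ?_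
      have h := hrel s hs
      rw [(haj s hs).deriv] at h
      linear_combination τ * h - b s * deriv b s * hτ)
  have hj0 : ∀ s ∈ I, j s ≠ 0 := fun s hs h0 => by
    refine h₂ s hs 0 ?_
    rw [hII s hs, (haj s hs).deriv, (hbj s hs).deriv, h0]
    linear_combination -(deriv V s * a s * b s ^ 2 * α ^ 2 * χ ^ 2 * τ * f s) * hτ
  obtain ⟨ρ, hρ⟩ : ∃ ρ : ℝ → ℝ, ρ = fun s => V s / j s := ⟨_, rfl⟩
  have hjρ : ∀ s ∈ I, j s * ρ s = V s := fun s hs => by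
    rw [hρ]; exact mul_div_cancel₀ _ (hj0 s hs)
  have hρ0 : ∀ s ∈ I, ρ s ≠ 0 := fun s hs h0 => by
    have := hjρ s hs
    rw [h0, mul_zero] at this
    exact (hV0 s hs).ne this
  have hρs : ContDiffOn ℝ ∞ ρ I := hρ ▸ hVs.div hjs hj0
  obtain ⟨ρ₁, hρd⟩ : ∃ ρ₁ : ℝ → ℝ, ∀ s ∈ I, HasDerivAt ρ (j s * ρ₁ s) s :=
    ⟨fun s => deriv ρ s / j s, fun s hs => (hasDerivAt_of_contDiffOn hI hρs s hs).congr_deriv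
      (mul_div_cancel₀ _ (hj0 s hs)).symm⟩
  have hfj : ∀ s ∈ I, HasDerivAt f (j s * ρ s * a s) s := fun s hs => by
    rw [hjρ s hs]; exact hfV s hs
  have hgj : ∀ s ∈ I, HasDerivAt g (j s * ρ s * b s) s := fun s hs => by
    rw [hjρ s hs]; exact hgV s hs
  refine ⟨fun s hs => ?_, η, hη, ?_⟩
  · rw [(hgV s hs).deriv]
    exact mul_ne_zero (hV0 s hs).ne' (hb0 s hs)
  have hL := F.laplaceIII_relation hI hc (t := -(α * τ)) hχ
    (by rw [neg_sq, mul_pow, hα, hτ, one_mul]) hη hX hn hbj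
    (fun s hs => ((haj s hs).const_mul (-(α * τ))).congr_deriv (by ring)) hab hfj hgj
    hjs.continuousOn hj0 hb0 (fun s hs => ((hbj s hs).mul (hρd s hs)).mul (haj s hs))
    (fun s hs => ((hbj s hs).mul (hρd s hs)).mul (hbj s hs)) hA
  obtain ⟨s₁, hs₁, hgs₁⟩ := exists_ne_of_hasDerivAt hI hs₀ (hgV s₀ hs₀)
    (mul_ne_zero (hV0 s₀ hs₀).ne' (hb0 s₀ hs₀))
  obtain ⟨l, μ, hlμ, hlx, hly⟩ := F.eigen_nonnull hτ0 hL (fun s hs => (hf0 s hs).ne') hs₀ hs₁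
    hgs₁ hv
  have e1 : ∀ s ∈ I, η * (-(α * τ) * a s ^ 2 * ρ s + a s * b s * ρ₁ s + ρ s * b s ^ 2) * b s
      - α * f s = -l * f s * b s ^ 2 := fun s hs => by
    have h1 := (hlμ s hs).1
    have h2 := hb0 s hs
    have h3 := hj0 s hs
    simp only [Pi.mul_apply] at h1
    field_simp at h1
    linear_combination -h1 + α * f s * hτ
  have e2 : ∀ s ∈ I, η * (-2 * (α * τ) * ρ s * a s + b s * ρ₁ s) = -μ * (g s + z) :=
    fun s hs => by
    have h1 := (hlμ s hs).2
    have h2 := hb0 s hs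
    have h3 := hj0 s hs
    simp only [Pi.mul_apply] at h1
    field_simp at h1
    refine mul_left_cancel₀ (pow_ne_zero 2 h2) ?_
    linear_combination -h1
  rcases profile_nonnull hI hc hs₀ hα hτ hη hfj (fun s hs => (hgj s hs).add_const z) haj hbj hρd
    (fun s hs => (hf0 s hs).ne') hj0 hb0 hρ0 hab' e1 e2 with
    ⟨-, k, hk, hk'⟩ | ⟨hl, c, hc0, hc'⟩
  · right
    -- The slope `a / b` is `df/dg`. With `f b = k` and `ρ b = α τ f` its derivative in `g` is `α η
    -- f / k ^ 2`, and `hinv` is the first integral.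
    have hm : ∀ s ∈ I, HasDerivAt (fun s => a s / b s)
        (j s * ρ s * b s * (α * η * f s / k ^ 2)) s := fun s hs => by
      have h2 := hb0 s hs
      refine ((haj s hs).div (hbj s hs) h2).congr_deriv ?_
      rw [mul_assoc (j s) (ρ s), (hk' s hs).2, ← (hk' s hs).1]
      have h3 := (hf0 s hs).ne'
      field_simp
      linear_combination j s * (hba s hs - τ * η * hα)
    have hfm : ∀ s ∈ I, HasDerivAt f (j s * ρ s * b s * (a s / b s)) s := fun s hs => by
      refine (hfj s hs).congr_deriv ?_
      have h2 := hb0 s hs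
      field_simp
    have hinv : ∀ s ∈ I, f s ^ 2 - α * η * (|k| ^ 2 * (a s / b s) ^ 2) = η * τ * |k| ^ 2 :=
      fun s hs => by
      have h2 := hb0 s hs
      rw [sq_abs, ← (hk' s hs).1]
      field_simp
      linear_combination f s ^ 2 * (-η * hab' s hs - hη)
    have hηα : α * η = 1 ∨ α * η = -1 := by
      rw [← mul_self_eq_one_iff]; linear_combination η ^ 2 * hα + hη
    have hητ : η * τ = 1 ∨ η * τ = -1 := by
      rw [← mul_self_eq_one_iff]; linear_combination η ^ 2 * hτ + hη
    have hk0 := abs_pos.2 hk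
    refine ⟨|k|, hk0, ?_⟩
    rcases hηα with h1 | h1
    · have hm' : ∀ s ∈ I, HasDerivAt (fun s => a s / b s) (j s * ρ s * b s * f s / |k| ^ 2) s :=
        fun s hs => (hm s hs).congr_deriv (by rw [sq_abs, h1]; ring)
      rcases hητ with h2 | h2
      · obtain ⟨d, hd⟩ := exists_eq_cosh hI hc hs₀ hk0 hfm hgj hm' fun s hs => by
          linear_combination hinv s hs + |k| ^ 2 * (a s / b s) ^ 2 * h1 + |k| ^ 2 * h2
        exact ⟨d, Or.inl ⟨h1, h2, hd⟩⟩
      · obtain ⟨d, hd⟩ := exists_eq_sinh hI hc hs₀ hk0 hfm hgj hm' fun s hs => by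
          linear_combination hinv s hs + |k| ^ 2 * (a s / b s) ^ 2 * h1 + |k| ^ 2 * h2
        exact ⟨d, Or.inr (Or.inl ⟨h1, h2, hd⟩)⟩
    · have hm' : ∀ s ∈ I, HasDerivAt (fun s => a s / b s) (-(j s * ρ s * b s * f s / |k| ^ 2)) s :=
        fun s hs => (hm s hs).congr_deriv (by rw [sq_abs, h1]; ring)
      -- The other sign would make the positive quantity `f ^ 2 + k ^ 2 (a / b) ^ 2` negative.
      have h2 : η * τ = 1 := hητ.resolve_right fun h2 => by
        have h3 := hinv s₀ hs₀
        rw [h1, h2] at h3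
        nlinarith [sq_pos_of_pos (hf0 s₀ hs₀), sq_pos_of_pos hk0,
          mul_nonneg (sq_nonneg |k|) (sq_nonneg (a s₀ / b s₀))]
      obtain ⟨d, hd⟩ := exists_eq_sin hI hc hs₀ hk0 hfm hgj hm' fun s hs => by
        linear_combination hinv s hs + |k| ^ 2 * (a s / b s) ^ 2 * h1 + |k| ^ 2 * h2
      exact ⟨d, Or.inr (Or.inr ⟨h1, h2, hd⟩)⟩
  · left
    refine ⟨(mul_eq_zero.1 hlx).resolve_left hl, (mul_eq_zero.1 hly).resolve_left hl,
      |c|, abs_pos.2 hc0, fun s hs => ?_⟩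
    rw [(hc' s hs).1, (hc' s hs).2, sq_abs]
    linear_combination c ^ 2 * α * hba s hs + α * b s ^ 2 * c ^ 2 * (τ ^ 2 * hα + hτ)
      - τ * c ^ 2 * a s ^ 2 * hα

/-- Both `C` and `e` are null, so a unit tangent satisfies `a b = -η`, and the nonvanishing of `a`
is automatic. -/
theorem null_classification (F : RotationFrame C D e 0 2 0 (-1 / 2) 0 1) {χ : ℝ}
    (hχ : χ ^ 2 = 1)
    (hCD : ∀ θ, cross (C θ) (D θ) = χ • C θ) (heD : ∀ θ, cross e (D θ) = -χ • e)
    (hI : IsOpen I) (hc : IsConnected I) {p r : ℝ → ℝ} (hp : ContDiffOn ℝ ∞ p I)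
    (hr : ContDiffOn ℝ ∞ r I) (hp0 : ∀ s ∈ I, p s ≠ 0)
    (hX : ∀ s ∈ I, ∀ θ, X s θ = p s • C θ + r s • e + v)
    (h₁ : ∀ s ∈ I, ∀ θ, (firstForm X s θ).det ≠ 0)
    (h₂ : ∀ s ∈ I, ∀ θ, (secondForm X s θ).det ≠ 0)
    {x y z : ℝ} (hv : v = x • C 0 + y • D 0 + z • e)
    {A : Matrix (Fin 3) (Fin 3) ℝ}
    (hA : ∀ s ∈ I, ∀ θ : ℝ, ∀ i : Fin 3,
      laplaceIII X (fun s θ => X s θ i) s θ = A.mulVec (X s θ) i) :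
    (∀ s ∈ I, deriv p s ≠ 0) ∧ ∃ η : ℝ, (η = 1 ∨ η = -1) ∧
      ((x = 0 ∧ y = 0 ∧ ∃ c, 0 < c ∧ ∀ s ∈ I, p s * (r s + z) = η * c ^ 2) ∨
        ∃ k, 0 < k ∧ ∃ d, ∀ s ∈ I, r s + d = η * k * p s ^ 3) := by
  obtain ⟨⟨s₀, hs₀⟩, hc⟩ := hc
  have hpd := hasDerivAt_of_contDiffOn hI hp
  have hrd := hasDerivAt_of_contDiffOn hI hr
  obtain ⟨η, V, a, b, hη, hVs, has, hbs, hV0, hpV, hrV, hab⟩ :=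
    exists_unit_tangent hI hc hp hr (α := 0) (β := -1 / 2) (γ := 0) fun s hs h0 => by
      have h := h₁ s hs 0
      rw [F.firstForm_det hI hX hpd hrd hs, h0, zero_mul] at h
      exact h rfl
  have hη0 : η ≠ 0 := fun h => by simp [h] at hη
  have hab' : ∀ s ∈ I, a s * b s = -η := fun s hs => by rw [← hab s hs]; ring
  have ha0 : ∀ s ∈ I, a s ≠ 0 := fun s hs h => hη0 (by simpa [h] using (hab' s hs).symm)
  have had := hasDerivAt_of_contDiffOn hI has
  have hbd := hasDerivAt_of_contDiffOn hI hbs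
  have hVd := hasDerivAt_of_contDiffOn hI hVs
  -- Unlike the radius `f` of the other cases, `p` may be negative; its constant sign enters the
  -- normal.
  obtain ⟨ς, hς, hpos⟩ := exists_sign hc hp.continuousOn hp0
  have hn : ∀ s ∈ I, ∀ θ, unitNormal X s θ = (ς * χ * a s) • C θ + (ς * χ * -b s) • e :=
    fun s hs θ => by
      have hcr : cross (dS X s θ) (dθ X s θ)
          = (ς * p s * V s) • ((ς * χ * a s) • C θ + (ς * χ * -b s) • e) := by
        rw [dS_rotation hI hs (hpV s hs) (hrV s hs) hX,
          dθ_rotation (F.hasDerivAt_C θ) (hX s hs), cross_smul_right, cross_add_left,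
          cross_smul_left, cross_smul_left, hCD, heD]
        rw [smul_add, smul_smul, smul_smul, smul_add, smul_smul, smul_smul, smul_smul, smul_smul]
        congr 2
        · linear_combination -(p s * V s * χ * a s) * hς
        · linear_combination (p s * V s * χ * b s) * hς
      have hpV0 := mul_pos (hpos s hs) (hV0 s hs)
      have hnn : lorentz (cross (dS X s θ) (dθ X s θ)) (cross (dS X s θ) (dθ X s θ))
          = -η * (ς * p s * V s) ^ 2 := by
        rw [hcr]
        simp only [lorentz_add_left, lorentz_smul_left, lorentz_add_right, lorentz_smul_right,
          F.CC, F.Ce, F.ee, F.eC]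
        linear_combination (ς * p s * V s) ^ 2 * (ς ^ 2 * χ ^ 2 * hab' s hs
          - η * (ς ^ 2 * hχ + hς))
      have h3 : |-η| = 1 := by
        rw [← abs_one, ← sq_eq_sq_iff_abs_eq_abs, neg_sq, hη]; norm_num
      rw [unitNormal, hnn, abs_mul, h3, one_mul, abs_of_nonneg (sq_nonneg _),
        Real.sqrt_sq hpV0.le, hcr, inv_smul_smul₀ hpV0.ne']
  have hII := fun s (hs : s ∈ I) => F.secondForm_det hI hX hpV hrV
    (fun s hs => (hVd s hs).mul (had s hs)) (fun s hs => (hVd s hs).mul (hbd s hs)) hs (hn s hs 0)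
  have hrel : ∀ s ∈ I, deriv a s * b s + a s * deriv b s = 0 := fun s hs =>
    derivs_eq_of_eqOn hI hab' hs ((had s hs).mul (hbd s hs)) (hasDerivAt_const s (-η))
  obtain ⟨j, hj⟩ : ∃ j : ℝ → ℝ, j = fun s => deriv a s / a s := ⟨_, rfl⟩
  have hjs : ContDiffOn ℝ ∞ j I := hj ▸ (contDiffOn_deriv hI has).div has ha0
  have haj : ∀ s ∈ I, HasDerivAt a (j s * a s) s := fun s hs =>
    (had s hs).congr_deriv (by rw [hj]; exact (div_mul_cancel₀ _ (ha0 s hs)).symm)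
  have hbj : ∀ s ∈ I, HasDerivAt b (-(j s * b s)) s := fun s hs =>
    (hbd s hs).congr_deriv (by
      refine mul_left_cancel₀ (ha0 s hs) ?_
      have h := hrel s hs
      rw [(haj s hs).deriv] at h
      linear_combination h)
  have hj0 : ∀ s ∈ I, j s ≠ 0 := fun s hs h0 => by
    refine h₂ s hs 0 ?_
    rw [hII s hs, (haj s hs).deriv, (hbj s hs).deriv, h0]; ring
  obtain ⟨ρ, hρ⟩ : ∃ ρ : ℝ → ℝ, ρ = fun s => V s / j s := ⟨_, rfl⟩
  have hjρ : ∀ s ∈ I, j s * ρ s = V s := fun s hs => by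
    rw [hρ]; exact mul_div_cancel₀ _ (hj0 s hs)
  have hρ0 : ∀ s ∈ I, ρ s ≠ 0 := fun s hs h0 => by
    have := hjρ s hs
    rw [h0, mul_zero] at this
    exact (hV0 s hs).ne this
  have hρs : ContDiffOn ℝ ∞ ρ I := hρ ▸ hVs.div hjs hj0
  obtain ⟨ρ₁, hρd⟩ : ∃ ρ₁ : ℝ → ℝ, ∀ s ∈ I, HasDerivAt ρ (j s * ρ₁ s) s :=
    ⟨fun s => deriv ρ s / j s, fun s hs => (hasDerivAt_of_contDiffOn hI hρs s hs).congr_deriv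
      (mul_div_cancel₀ _ (hj0 s hs)).symm⟩
  have hpj : ∀ s ∈ I, HasDerivAt p (j s * ρ s * a s) s := fun s hs => by
    rw [hjρ s hs]; exact hpV s hs
  have hrj : ∀ s ∈ I, HasDerivAt r (j s * ρ s * b s) s := fun s hs => by
    rw [hjρ s hs]; exact hrV s hs
  refine ⟨fun s hs => ?_, ?_⟩
  · rw [(hpV s hs).deriv]
    exact mul_ne_zero (hV0 s hs).ne' (ha0 s hs)
  have hη1 : η = 1 ∨ η = -1 := by rw [← mul_self_eq_one_iff, ← sq, hη]
  have hL := F.laplaceIII_relation hI hc (t := 1) (by rw [mul_pow, hς, hχ, one_mul])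
    (one_pow 2) hη hX hn (fun s hs => (haj s hs).congr_deriv (by ring))
    (fun s hs => (hbj s hs).neg.congr_deriv (by ring)) hab hpj hrj
    hjs.continuousOn hj0 ha0 (fun s hs => ((haj s hs).mul (hρd s hs)).mul (haj s hs))
    (fun s hs => ((haj s hs).mul (hρd s hs)).mul (hbj s hs)) hA
  obtain ⟨s₁, hs₁, hps₁⟩ := exists_ne_of_hasDerivAt hI hs₀ (hpV s₀ hs₀)
    (mul_ne_zero (hV0 s₀ hs₀).ne' (ha0 s₀ hs₀))
  obtain ⟨l, ν, hlν, hlx, hly⟩ := F.eigen_null two_ne_zero hL hp0 hs₀ hs₁ hps₁ hv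
  have e1 : ∀ s ∈ I, -η * (2 * a s * ρ s + a s * ρ₁ s) = l * p s := fun s hs => by
    have h1 := (hlν s hs).1
    have h2 := ha0 s hs
    have h3 := hj0 s hs
    rw [← h1]
    simp only [Pi.mul_apply]
    field_simp
    ring
  have e2 : ∀ s ∈ I, ρ₁ s - 2 * p s / a s = a s * (l * (r s + z) + ν * (p s + x)) :=
    fun s hs => by
    have h1 := (hlν s hs).2
    have h2 := ha0 s hs
    have h3 := hj0 s hs
    rw [← h1]
    simp only [Pi.mul_apply]
    field_simp
    linear_combination -ρ₁ s * a s * hη + η * a s * ρ₁ s * hab' s hs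
  rcases profile_null hI hc hs₀ hη hpj hrj haj hρd hp0 hj0 hρ0 hab' e1 e2 with
    ⟨-, k, hk, hk'⟩ | ⟨hl, c, hc0, hc'⟩
  -- From `p a = k` and `a b = -η`, `dr/dp = b / a = -η p ^ 2 / k ^ 2`, which integrates to a cubic.
  -- Its sign is opposite to `η`, whence the witness `-η`.
  · have hconst := const_of_hasDerivAt_zero hI hc (fun s hs =>
      ((hrj s hs).add (((hpj s hs).pow 3).const_mul (η / (3 * k ^ 2)))).congr_deriv (g' := 0) (by
        obtain ⟨h1, h2⟩ := hk' s hs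
        have h3 := hp0 s hs
        have h4 := ha0 s hs
        have h5 : ρ s = -p s / a s := by field_simp; exact h2
        have h6 : b s = -η / a s := by field_simp; linear_combination hab' s hs
        rw [h5, h6, ← h1]
        push_cast
        field_simp
        ring)) hs₀
    refine ⟨-η, by rcases hη1 with h | h <;> simp [h], Or.inr ⟨1 / (3 * k ^ 2), by positivity,
      -(r s₀ + η / (3 * k ^ 2) * p s₀ ^ 3), fun s hs => ?_⟩⟩
    have h := hconst s hs
    simp only [Pi.add_apply, Pi.pow_apply] at h
    linear_combination h
  · refine ⟨η, hη1, Or.inl ⟨(mul_eq_zero.1 hlx).resolve_left hl,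
      (mul_eq_zero.1 hly).resolve_left hl, |c|, abs_pos.2 hc0, fun s hs => ?_⟩⟩
    rw [(hc' s hs).1, (hc' s hs).2, sq_abs]
    linear_combination -c ^ 2 * hab' s hs

end RotationFrame

/-! ### The frames of the standard rotations -/

theorem hasDerivAt_vec3 {f₀ f₁ f₂ : ℝ → ℝ} {f₀' f₁' f₂' θ : ℝ} (h₀ : HasDerivAt f₀ f₀' θ)
    (h₁ : HasDerivAt f₁ f₁' θ) (h₂ : HasDerivAt f₂ f₂' θ) :
    HasDerivAt (fun θ => (![f₀ θ, f₁ θ, f₂ θ] : E31)) ![f₀', f₁', f₂'] θ := by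
  rw [hasDerivAt_pi]
  intro i
  fin_cases i
  · exact h₀
  · exact h₁
  · exact h₂

theorem rotationFrame_spacelike₁ :
    RotationFrame (fun θ => ![Real.cosh θ, 0, Real.sinh θ]) (fun θ => ![Real.sinh θ, 0, Real.cosh θ])
      ![0, 1, 0] 1 0 1 0 1 (-(1 * 1)) where
  hasDerivAt_C θ := hasDerivAt_vec3 (Real.hasDerivAt_cosh θ) (hasDerivAt_const θ 0)
    (Real.hasDerivAt_sinh θ)
  hasDerivAt_D θ := by
    convert hasDerivAt_vec3 (Real.hasDerivAt_sinh θ) (hasDerivAt_const θ 0)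
      (Real.hasDerivAt_cosh θ) using 1
    simp
  CC θ := by simp [lorentz]; linear_combination Real.cosh_sq θ
  Ce θ := by simp [lorentz]
  ee := by simp [lorentz]
  DD θ := by simp [lorentz]; linear_combination -Real.cosh_sq θ
  CD θ := by simp [lorentz]; ring
  eD θ := by simp [lorentz]
  rel_C := by norm_num
  rel_e := by norm_num
  gram := by norm_num
  ε_sq := by norm_num

theorem rotationFrame_spacelike₂ :
    RotationFrame (fun θ => ![Real.sinh θ, 0, Real.cosh θ]) (fun θ => ![Real.cosh θ, 0, Real.sinh θ])
      ![0, 1, 0] 1 0 (-1) 0 1 (-(-1 * 1)) where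
  hasDerivAt_C θ := hasDerivAt_vec3 (Real.hasDerivAt_sinh θ) (hasDerivAt_const θ 0)
    (Real.hasDerivAt_cosh θ)
  hasDerivAt_D θ := by
    convert hasDerivAt_vec3 (Real.hasDerivAt_cosh θ) (hasDerivAt_const θ 0)
      (Real.hasDerivAt_sinh θ) using 1
    simp
  CC θ := by simp [lorentz]; linear_combination -Real.cosh_sq θ
  Ce θ := by simp [lorentz]
  ee := by simp [lorentz]
  DD θ := by simp [lorentz]; linear_combination Real.cosh_sq θ
  CD θ := by simp [lorentz]; ring
  eD θ := by simp [lorentz]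
  rel_C := by norm_num
  rel_e := by norm_num
  gram := by norm_num
  ε_sq := by norm_num

theorem rotationFrame_timelike :
    RotationFrame (fun θ => ![Real.cos θ, Real.sin θ, 0]) (fun θ => ![-Real.sin θ, Real.cos θ, 0])
      ![0, 0, 1] (-1) 0 1 0 (-1) (-(1 * -1)) where
  hasDerivAt_C θ := hasDerivAt_vec3 (Real.hasDerivAt_cos θ) (Real.hasDerivAt_sin θ)
    (hasDerivAt_const θ 0)
  hasDerivAt_D θ := by
    convert hasDerivAt_vec3 (Real.hasDerivAt_sin θ).fun_neg (Real.hasDerivAt_cos θ)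
      (hasDerivAt_const θ 0) using 1
    simp
  CC θ := by simp [lorentz]; linear_combination Real.sin_sq_add_cos_sq θ
  Ce θ := by simp [lorentz]
  ee := by simp [lorentz]
  DD θ := by simp [lorentz]; linear_combination Real.sin_sq_add_cos_sq θ
  CD θ := by simp [lorentz]; ring
  eD θ := by simp [lorentz]
  rel_C := by norm_num
  rel_e := by norm_num
  gram := by norm_num
  ε_sq := by norm_num

/-- With this `C` and `e`, `revNull f g` has frame coordinates `p = f - g` and `r = f + g`. -/
theorem rotationFrame_null :
    RotationFrame (fun θ => ![θ, (θ ^ 2 - 1) / 2, (θ ^ 2 + 1) / 2]) (fun θ => ![1, θ, θ])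
      ![0, 1 / 2, 1 / 2] 0 2 0 (-1 / 2) 0 1 where
  hasDerivAt_C θ := hasDerivAt_vec3 (hasDerivAt_id θ)
    (((((hasDerivAt_id θ).pow 2).sub_const 1).div_const 2).congr_deriv (by simp))
    (((((hasDerivAt_id θ).pow 2).add_const 1).div_const 2).congr_deriv (by simp))
  hasDerivAt_D θ :=
    (hasDerivAt_vec3 (hasDerivAt_const θ 1) (hasDerivAt_id θ) (hasDerivAt_id θ)).congr_deriv
      (by ext i; fin_cases i <;> simp)
  CC θ := by simp [lorentz]; ring
  Ce θ := by simp [lorentz]; ring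
  ee := by simp [lorentz]
  DD θ := by simp [lorentz]
  CD θ := by simp [lorentz]; ring
  eD θ := by simp [lorentz]
  rel_C := by norm_num
  rel_e := by norm_num
  gram := by norm_num
  ε_sq := by norm_num

theorem RotationFrame.map {C D : ℝ → E31} {e : E31} {τ κ α β γ ε : ℝ}
    (F : RotationFrame C D e τ κ α β γ ε) {T : E31 →ₗ[ℝ] E31}
    (hT : ∀ u w, lorentz (T u) (T w) = lorentz u w) :
    RotationFrame (fun θ => T (C θ)) (fun θ => T (D θ)) (T e) τ κ α β γ ε where
  hasDerivAt_C θ := T.toContinuousLinearMap.hasFDerivAt.comp_hasDerivAt θ (F.hasDerivAt_C θ)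
  hasDerivAt_D θ := by
    have := T.toContinuousLinearMap.hasFDerivAt.comp_hasDerivAt θ (F.hasDerivAt_D θ)
    rw [map_add, map_smul, map_smul] at this
    exact this
  CC θ := by rw [hT, F.CC]
  Ce θ := by rw [hT, F.Ce]
  ee := by rw [hT, F.ee]
  DD θ := by rw [hT, F.DD]
  CD θ := by rw [hT, F.CD]
  eD θ := by rw [hT, F.eD]
  rel_C := F.rel_C
  rel_e := F.rel_e
  gram := F.gram
  ε_sq := F.ε_sq

/-! ### Open parts -/

/-- By the inverse function theorem the map is locally open. -/
theorem isOpen_image_of_deriv_ne_zero {I : Set ℝ} (hI : IsOpen I) {g : ℝ → ℝ}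
    (hg : ContDiffOn ℝ ∞ g I) (h : ∀ s ∈ I, deriv g s ≠ 0) : IsOpen (g '' I) := by
  rw [isOpen_iff_mem_nhds]
  rintro _ ⟨s, hs, rfl⟩
  have h1 := ((hg.contDiffAt (hI.mem_nhds hs)).hasStrictDerivAt (by simp)).map_nhds_eq (h s hs)
  rw [← h1]
  exact Filter.image_mem_map (hI.mem_nhds hs)

section OpenPart

variable {I : Set ℝ} {f g : ℝ → ℝ} {S : Set E31}

/-- The trace is cut out of `S` by the open condition that the height lies in `g '' I`, and by `q 0
> 0`, since the orbit is only one branch of a hyperbola. -/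
theorem isOpenPart_revSpacelike₁ (hf : ∀ s ∈ I, 0 < f s) (hg : IsOpen (g '' I))
    (hS : ∀ q : E31, ∀ s ∈ I, q 1 = g s → (q ∈ S ↔ q 0 ^ 2 - q 2 ^ 2 = f s ^ 2)) :
    IsOpenPart (trace I (revSpacelike₁ f g)) S := by
  refine ⟨{q | q 1 ∈ g '' I} ∩ {q | 0 < q 0}, (hg.preimage (continuous_apply 1)).inter
    (isOpen_lt continuous_const (continuous_apply 0)), ?_⟩
  ext q
  constructor
  · rintro ⟨s, hs, θ, rfl⟩
    refine ⟨(hS _ s hs rfl).2 ?_, ⟨s, hs, rfl⟩, mul_pos (hf s hs) (Real.cosh_pos θ)⟩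
    simp [revSpacelike₁]
    linear_combination f s ^ 2 * Real.cosh_sq θ
  · rintro ⟨hq, ⟨s, hs, h1⟩, h0⟩
    have h2 := (hS q s hs h1.symm).1 hq
    have h3 := hf s hs
    obtain ⟨θ, hc, hs'⟩ := exists_cosh_sinh_eq (x := q 0 / f s) (y := q 2 / f s) (div_pos h0 h3)
      (by field_simp; exact h2)
    refine ⟨s, hs, θ, ?_⟩
    ext i
    fin_cases i <;> simp [revSpacelike₁, ← hc, ← hs', h1] <;> field_simp

theorem isOpenPart_revSpacelike₂ (hf : ∀ s ∈ I, 0 < f s) (hg : IsOpen (g '' I))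
    (hS : ∀ q : E31, ∀ s ∈ I, q 1 = g s → (q ∈ S ↔ q 2 ^ 2 - q 0 ^ 2 = f s ^ 2)) :
    IsOpenPart (trace I (revSpacelike₂ f g)) S := by
  refine ⟨{q | q 1 ∈ g '' I} ∩ {q | 0 < q 2}, (hg.preimage (continuous_apply 1)).inter
    (isOpen_lt continuous_const (continuous_apply 2)), ?_⟩
  ext q
  constructor
  · rintro ⟨s, hs, θ, rfl⟩
    refine ⟨(hS _ s hs rfl).2 ?_, ⟨s, hs, rfl⟩, mul_pos (hf s hs) (Real.cosh_pos θ)⟩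
    simp [revSpacelike₂]
    linear_combination f s ^ 2 * Real.cosh_sq θ
  · rintro ⟨hq, ⟨s, hs, h1⟩, h0⟩
    have h2 := (hS q s hs h1.symm).1 hq
    have h3 := hf s hs
    obtain ⟨θ, hc, hs'⟩ := exists_cosh_sinh_eq (x := q 2 / f s) (y := q 0 / f s) (div_pos h0 h3)
      (by field_simp; exact h2)
    refine ⟨s, hs, θ, ?_⟩
    ext i
    fin_cases i <;> simp [revSpacelike₂, ← hc, ← hs', h1] <;> field_simp

theorem isOpenPart_revTimelike (hf : ∀ s ∈ I, 0 < f s) (hg : IsOpen (g '' I))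
    (hS : ∀ q : E31, ∀ s ∈ I, q 2 = g s → (q ∈ S ↔ q 0 ^ 2 + q 1 ^ 2 = f s ^ 2)) :
    IsOpenPart (trace I (revTimelike f g)) S := by
  refine ⟨{q | q 2 ∈ g '' I}, hg.preimage (continuous_apply 2), ?_⟩
  ext q
  constructor
  · rintro ⟨s, hs, θ, rfl⟩
    refine ⟨(hS _ s hs rfl).2 ?_, ⟨s, hs, rfl⟩⟩
    simp [revTimelike]
    linear_combination f s ^ 2 * Real.sin_sq_add_cos_sq θ
  · rintro ⟨hq, s, hs, h1⟩
    have h2 := (hS q s hs h1.symm).1 hq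
    have h3 := hf s hs
    obtain ⟨θ, hc, hs'⟩ := exists_cos_sin_eq (x := q 0 / f s) (y := q 1 / f s)
      (by field_simp; exact h2)
    refine ⟨s, hs, θ, ?_⟩
    ext i
    fin_cases i <;> simp [revTimelike, ← hc, ← hs', h1] <;> field_simp

/-- The rotation fixes the null coordinate `q 2 - q 1`, which serves as height. The parameter is
recovered as `θ = q 0 / (f - g)`, and the quadric equation then fixes `q 1 + q 2`. -/
theorem isOpenPart_revNull (hfg : ∀ s ∈ I, f s - g s ≠ 0) (ho : IsOpen ((fun s => f s - g s) '' I))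
    (hS : ∀ q : E31, ∀ s ∈ I, q 2 - q 1 = f s - g s →
      (q ∈ S ↔ q 0 ^ 2 + q 1 ^ 2 - q 2 ^ 2 = g s ^ 2 - f s ^ 2)) :
    IsOpenPart (trace I (revNull f g)) S := by
  refine ⟨{q | q 2 - q 1 ∈ (fun s => f s - g s) '' I},
    ho.preimage ((continuous_apply 2).sub (continuous_apply 1)), ?_⟩
  ext q
  constructor
  · rintro ⟨s, hs, θ, rfl⟩
    have h : revNull f g s θ 2 - revNull f g s θ 1 = f s - g s := by simp [revNull]
    refine ⟨(hS _ s hs h).2 ?_, ⟨s, hs, h.symm⟩⟩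
    simp [revNull]
    ring
  · rintro ⟨hq, s, hs, h1⟩
    simp only [] at h1
    have h2 := (hS q s hs h1.symm).1 hq
    have h3 := hfg s hs
    have h4 : q 1 + q 2 = f s + g s + q 0 ^ 2 / (f s - g s) := by
      field_simp
      rw [h1] at h3 ⊢
      linear_combination -h2 + (f s + g s) * h1
    refine ⟨s, hs, q 0 / (f s - g s), ?_⟩
    have h5 : (q 0 / (f s - g s)) ^ 2 / 2 * (f s - g s) = q 0 ^ 2 / (f s - g s) / 2 := by
      field_simp
    ext i
    fin_cases i
    · simp [revNull]; field_simp
    · simp [revNull, h5]; linear_combination h4 / 2 + h1 / 2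
    · simp [revNull, h5]; linear_combination h4 / 2 - h1 / 2

variable {X Y Y' : ℝ → ℝ → E31} {T : E31 →ₗ[ℝ] E31} {u v : E31}

theorem isOpenPart_image (hT : ∀ u w, lorentz (T u) (T w) = lorentz u w) {M : Set E31}
    (h : IsOpenPart M S) : IsOpenPart ((fun q => T q + v) '' M) ((fun q => T q + v) '' S) := by
  obtain ⟨U, hU, rfl⟩ := h
  have hinj : Function.Injective fun q => T q + v :=
    (add_left_injective v).comp (injective_of_lorentz hT)
  refine ⟨(fun q => T q + v) '' U, ?_, Set.image_inter hinj⟩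
  have hopen : IsOpenMap T := by
    exact (LinearEquiv.ofInjectiveEndo T
      (injective_of_lorentz hT)).toContinuousLinearEquiv.toHomeomorph.isOpenMap
  exact (isOpenMap_add_right v).comp hopen U hU

/-- The shift `u` along the axis brings the profile to the normalised position of the model; the
congruence compensates for it. -/
theorem trace_eq_image (hX : ∀ s ∈ I, ∀ θ, X s θ = T (Y s θ) + v)
    (hY : ∀ s ∈ I, ∀ θ, Y' s θ = Y s θ + u) :
    trace I X = (fun q => T q + (v - T u)) '' trace I Y' := by
  have h : ∀ s ∈ I, ∀ θ, X s θ = T (Y' s θ) + (v - T u) := fun s hs θ => by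
    rw [hX s hs, hY s hs, map_add]; abel
  ext q
  constructor
  · rintro ⟨s, hs, θ, rfl⟩
    exact ⟨_, ⟨s, hs, θ, rfl⟩, (h s hs θ).symm⟩
  · rintro ⟨_, ⟨s, hs, θ, rfl⟩, rfl⟩
    exact ⟨s, hs, θ, (h s hs θ).symm⟩

theorem isOpenPartOfCopy_trace (hT : ∀ u w, lorentz (T u) (T w) = lorentz u w)
    (hX : ∀ s ∈ I, ∀ θ, X s θ = T (Y s θ) + v) (hY : ∀ s ∈ I, ∀ θ, Y' s θ = Y s θ + u)
    {k : ℝ} (hk : 0 < k) {S : ℝ → Set E31} (h : IsOpenPart (trace I Y') (S k)) :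
    IsOpenPartOfCopy (trace I X) S := by
  refine ⟨k, hk, fun q => T q + (v - T u), ⟨T, _, hT, fun _ => rfl⟩, ?_⟩
  rw [trace_eq_image hX hY]
  exact isOpenPart_image hT h

/-- When the translation is the image of `u`, only the linear isometry remains, and it preserves the
quadric; no congruence appears in the conclusion. -/
theorem isOpenPart_sphere_trace (hT : ∀ u w, lorentz (T u) (T w) = lorentz u w)
    (hX : ∀ s ∈ I, ∀ θ, X s θ = T (Y s θ) + T u) (hY : ∀ s ∈ I, ∀ θ, Y' s θ = Y s θ + u)
    {K : ℝ} (h : IsOpenPart (trace I Y') {q | lorentz q q = K}) :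
    IsOpenPart (trace I X) {q | lorentz q q = K} := by
  rw [trace_eq_image hX hY]
  convert isOpenPart_image hT h using 1
  ext q
  simp only [sub_self, add_zero, Set.mem_image, Set.mem_ofPred_eq]
  constructor
  · intro hq
    obtain ⟨q, rfl⟩ := surjective_of_lorentz hT q
    exact ⟨q, by rwa [hT] at hq, rfl⟩
  · rintro ⟨q, hq, rfl⟩
    rw [hT, hq]

end OpenPart

/-! ### Classification -/

theorem isOpen_image_add_const {I : Set ℝ} (hI : IsOpen I) {g : ℝ → ℝ} (hg : ContDiffOn ℝ ∞ g I)
    (h : ∀ s ∈ I, deriv g s ≠ 0) (d : ℝ) : IsOpen ((fun s => g s + d) '' I) :=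
  isOpen_image_of_deriv_ne_zero hI (hg.add contDiffOn_const) fun s hs => by
    rw [deriv_add_const]; exact h s hs

theorem cross_map {T : E31 →ₗ[ℝ] E31} (hT : ∀ u w, lorentz (T u) (T w) = lorentz u w)
    {u w e : E31} {k : ℝ} (h : cross u w = k • e) :
    cross (T u) (T w) = (k * LinearMap.det T) • T e := by
  rw [cross_apply_apply hT, h, map_smul, smul_smul, mul_comm]

section

variable {I : Set ℝ} {X : ℝ → ℝ → E31} {f g : ℝ → ℝ} {T : E31 →ₗ[ℝ] E31} {w : E31}
  {A : Matrix (Fin 3) (Fin 3) ℝ}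

/-- Here `α = τ = 1`. The spherical equation rules out `η = -1`, and among the minimal profiles only
`cosh` has compatible signs. -/
theorem classification_spacelike₁ (hI : IsOpen I) (hc : IsConnected I)
    (hf : ContDiffOn ℝ ∞ f I) (hg : ContDiffOn ℝ ∞ g I) (hf0 : ∀ s ∈ I, 0 < f s)
    (hT : ∀ u w, lorentz (T u) (T w) = lorentz u w)
    (hX : ∀ s ∈ I, ∀ θ, X s θ = T (revSpacelike₁ f g s θ) + T w)
    (h₁ : ∀ s ∈ I, ∀ θ, (firstForm X s θ).det ≠ 0)
    (h₂ : ∀ s ∈ I, ∀ θ, (secondForm X s θ).det ≠ 0)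
    (hA : ∀ s ∈ I, ∀ θ : ℝ, ∀ i : Fin 3,
      laplaceIII X (fun s θ => X s θ i) s θ = A.mulVec (X s θ) i) :
    IsOpenPartOfCopy (trace I X) catenoid₅ ∨ ∃ c, 0 < c ∧ IsOpenPart (trace I X) (pseudosphere c) := by
  obtain ⟨hg0, η, hη, h⟩ := (rotationFrame_spacelike₁.map hT).nonnull_classification
    (χ := LinearMap.det T) (x := w 0) (y := w 2) (z := w 1) (v := T w)
    (by norm_num) (by norm_num) (det_sq_of_lorentz hT)
    (fun θ => cross_map hT (by
      ext i; fin_cases i <;> simp [cross]; linear_combination -Real.cosh_sq θ))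
    (fun θ => by
      rw [cross_map hT (e := ![Real.cosh θ, 0, Real.sinh θ]) (k := 1) (by
        ext i; fin_cases i <;> simp [cross]), one_mul])
    hI hc hf hg hf0
    (fun s hs θ => by
      rw [hX s hs, ← map_smul, ← map_smul, ← map_add, ← map_add, ← map_add]
      refine congrArg T ?_
      ext i; fin_cases i <;> simp [revSpacelike₁])
    h₁ h₂
    (by
      rw [← map_smul, ← map_smul, ← map_smul, ← map_add, ← map_add]
      refine congrArg T ?_
      ext i; fin_cases i <;> simp) hA
  have hY : ∀ d, ∀ s ∈ I, ∀ θ, revSpacelike₁ f (fun s => g s + d) s θ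
      = revSpacelike₁ f g s θ + ![0, d, 0] := fun d s _ θ => by
    ext i; fin_cases i <;> simp [revSpacelike₁]
  have hpart : ∀ d S, (∀ q : E31, ∀ s ∈ I, q 1 = g s + d → (q ∈ S ↔ q 0 ^ 2 - q 2 ^ 2 = f s ^ 2)) →
      IsOpenPart (trace I (revSpacelike₁ f (fun s => g s + d))) S := fun d S hS =>
    isOpenPart_revSpacelike₁ hf0 (isOpen_image_add_const hI hg hg0 d) hS
  rcases h with ⟨hx, hy, c, hc0, h⟩ | ⟨k, hk, d, ⟨h3, h4, h⟩ | ⟨h3, h4, h⟩ | ⟨h3, h4, h⟩⟩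
  · right
    have hη : η = 1 := by
      obtain ⟨s, hs⟩ := hc.nonempty
      have h0 := h s hs
      have h1 := sq_pos_of_pos (hf0 s hs)
      rcases sq_eq_one_iff.1 hη with h | h
      · exact h
      · rw [h] at h0
        nlinarith [sq_nonneg (g s + w 1), sq_nonneg c]
    refine ⟨c, hc0, isOpenPart_sphere_trace hT (u := ![0, w 1, 0]) (fun s hs θ => ?_) (hY (w 1))
      (hpart (w 1) _ fun q s hs hq => ?_)⟩
    · rw [hX s hs]
      refine congrArg (fun u => T (revSpacelike₁ f g s θ) + T u) ?_
      ext i; fin_cases i <;> simp [hx, hy]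
    · have h5 := h s hs
      rw [← hq, hη] at h5
      simp only [Set.mem_ofPred_eq, lorentz]
      constructor <;> intro h'
      · linear_combination h' - h5
      · linear_combination h' + h5
  · left
    refine isOpenPartOfCopy_trace hT hX (hY d) hk (hpart d _ fun q s hs hq => ?_)
    rw [h s hs, ← hq]
    simp [catenoid₅]
  · exfalso; linarith
  · exfalso; linarith

/-- Here `α = -1`, `τ = 1`: `η = 1` gives `sin` or the hyperbolic space, `η = -1` gives `sinh` or
the pseudosphere. The condition `sin ≠ 0` or `sinh ≠ 0` follows from `f > 0`. -/
theorem classification_spacelike₂ (hI : IsOpen I) (hc : IsConnected I)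
    (hf : ContDiffOn ℝ ∞ f I) (hg : ContDiffOn ℝ ∞ g I) (hf0 : ∀ s ∈ I, 0 < f s)
    (hT : ∀ u w, lorentz (T u) (T w) = lorentz u w)
    (hX : ∀ s ∈ I, ∀ θ, X s θ = T (revSpacelike₂ f g s θ) + T w)
    (h₁ : ∀ s ∈ I, ∀ θ, (firstForm X s θ).det ≠ 0)
    (h₂ : ∀ s ∈ I, ∀ θ, (secondForm X s θ).det ≠ 0)
    (hA : ∀ s ∈ I, ∀ θ : ℝ, ∀ i : Fin 3,
      laplaceIII X (fun s θ => X s θ i) s θ = A.mulVec (X s θ) i) :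
    IsOpenPartOfCopy (trace I X) catenoid₂ ∨ IsOpenPartOfCopy (trace I X) catenoid₄ ∨
      (∃ c, 0 < c ∧ IsOpenPart (trace I X) (pseudosphere c)) ∨
      ∃ c, 0 < c ∧ IsOpenPart (trace I X) (hyperbolicSpace c) := by
  obtain ⟨hg0, η, hη, h⟩ := (rotationFrame_spacelike₂.map hT).nonnull_classification
    (χ := LinearMap.det T) (x := w 2) (y := w 0) (z := w 1) (v := T w)
    (by norm_num) (by norm_num) (det_sq_of_lorentz hT)
    (fun θ => cross_map hT (by
      ext i; fin_cases i <;> simp [cross]; linear_combination Real.cosh_sq θ))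
    (fun θ => by
      rw [cross_map hT (e := ![Real.sinh θ, 0, Real.cosh θ]) (k := 1) (by
        ext i; fin_cases i <;> simp [cross]), one_mul])
    hI hc hf hg hf0
    (fun s hs θ => by
      rw [hX s hs, ← map_smul, ← map_smul, ← map_add, ← map_add, ← map_add]
      refine congrArg T ?_
      ext i; fin_cases i <;> simp [revSpacelike₂])
    h₁ h₂
    (by
      rw [← map_smul, ← map_smul, ← map_smul, ← map_add, ← map_add]
      refine congrArg T ?_
      ext i; fin_cases i <;> simp) hA
  have hY : ∀ d, ∀ s ∈ I, ∀ θ, revSpacelike₂ f (fun s => g s + d) s θ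
      = revSpacelike₂ f g s θ + ![0, d, 0] := fun d s _ θ => by
    ext i; fin_cases i <;> simp [revSpacelike₂]
  have hpart : ∀ d S, (∀ q : E31, ∀ s ∈ I, q 1 = g s + d → (q ∈ S ↔ q 2 ^ 2 - q 0 ^ 2 = f s ^ 2)) →
      IsOpenPart (trace I (revSpacelike₂ f (fun s => g s + d))) S := fun d S hS =>
    isOpenPart_revSpacelike₂ hf0 (isOpen_image_add_const hI hg hg0 d) hS
  rcases h with ⟨hx, hy, c, hc0, h⟩ | ⟨k, hk, d, ⟨h3, h4, h⟩ | ⟨h3, h4, h⟩ | ⟨h3, h4, h⟩⟩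
  · right; right
    rcases sq_eq_one_iff.1 hη with hη | hη
    · right
      refine ⟨c, hc0, isOpenPart_sphere_trace hT (u := ![0, w 1, 0]) (fun s hs θ => ?_) (hY (w 1))
        (hpart (w 1) _ fun q s hs hq => ?_)⟩
      · rw [hX s hs]
        refine congrArg (fun u => T (revSpacelike₂ f g s θ) + T u) ?_
        ext i; fin_cases i <;> simp [hx, hy]
      · have h5 := h s hs
        rw [← hq, hη] at h5
        simp only [Set.mem_ofPred_eq, lorentz]
        constructor <;> intro h'
        · linear_combination h5 - h'
        · linear_combination h5 - h'
    · left
      refine ⟨c, hc0, isOpenPart_sphere_trace hT (u := ![0, w 1, 0]) (fun s hs θ => ?_) (hY (w 1))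
        (hpart (w 1) _ fun q s hs hq => ?_)⟩
      · rw [hX s hs]
        refine congrArg (fun u => T (revSpacelike₂ f g s θ) + T u) ?_
        ext i; fin_cases i <;> simp [hx, hy]
      · have h5 := h s hs
        rw [← hq, hη] at h5
        simp only [Set.mem_ofPred_eq, lorentz]
        constructor <;> intro h'
        · linear_combination h5 - h'
        · linear_combination h5 - h'
  · exfalso; linarith
  · right; left
    refine isOpenPartOfCopy_trace hT hX (hY d) hk (hpart d _ fun q s hs hq => ?_)
    have h0 := pow_pos (hf0 s hs) 2
    rw [h s hs] at h0 ⊢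
    rw [← hq] at h0 ⊢
    exact and_iff_left fun h5 => by simp [h5] at h0
  · left
    refine isOpenPartOfCopy_trace hT hX (hY d) hk (hpart d _ fun q s hs hq => ?_)
    have h0 := pow_pos (hf0 s hs) 2
    rw [h s hs] at h0 ⊢
    rw [← hq] at h0 ⊢
    exact and_iff_left fun h5 => by simp [h5] at h0

/-- Here `α = 1`, `τ = -1`: `η = 1` gives `sinh` or the hyperbolic space, `η = -1` gives `sin` or
the pseudosphere. -/
theorem classification_timelike (hI : IsOpen I) (hc : IsConnected I)
    (hf : ContDiffOn ℝ ∞ f I) (hg : ContDiffOn ℝ ∞ g I) (hf0 : ∀ s ∈ I, 0 < f s)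
    (hT : ∀ u w, lorentz (T u) (T w) = lorentz u w)
    (hX : ∀ s ∈ I, ∀ θ, X s θ = T (revTimelike f g s θ) + T w)
    (h₁ : ∀ s ∈ I, ∀ θ, (firstForm X s θ).det ≠ 0)
    (h₂ : ∀ s ∈ I, ∀ θ, (secondForm X s θ).det ≠ 0)
    (hA : ∀ s ∈ I, ∀ θ : ℝ, ∀ i : Fin 3,
      laplaceIII X (fun s θ => X s θ i) s θ = A.mulVec (X s θ) i) :
    IsOpenPartOfCopy (trace I X) catenoid₁ ∨ IsOpenPartOfCopy (trace I X) catenoid₃ ∨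
      (∃ c, 0 < c ∧ IsOpenPart (trace I X) (pseudosphere c)) ∨
      ∃ c, 0 < c ∧ IsOpenPart (trace I X) (hyperbolicSpace c) := by
  obtain ⟨hg0, η, hη, h⟩ := (rotationFrame_timelike.map hT).nonnull_classification
    (χ := -1 * LinearMap.det T) (x := w 0) (y := w 1) (z := w 2) (v := T w)
    (by norm_num) (by norm_num) (by rw [mul_pow, det_sq_of_lorentz hT]; norm_num)
    (fun θ => by
      rw [cross_map hT (e := ![0, 0, 1]) (k := -1) (by
        ext i; fin_cases i <;> simp [cross]; linear_combination -Real.sin_sq_add_cos_sq θ)]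
      congr 1; ring)
    (fun θ => by
      rw [cross_map hT (e := ![Real.cos θ, Real.sin θ, 0]) (k := -1) (by
        ext i; fin_cases i <;> simp [cross])])
    hI hc hf hg hf0
    (fun s hs θ => by
      rw [hX s hs, ← map_smul, ← map_smul, ← map_add, ← map_add, ← map_add]
      refine congrArg T ?_
      ext i; fin_cases i <;> simp [revTimelike])
    h₁ h₂
    (by
      rw [← map_smul, ← map_smul, ← map_smul, ← map_add, ← map_add]
      refine congrArg T ?_
      ext i; fin_cases i <;> simp) hA
  have hY : ∀ d, ∀ s ∈ I, ∀ θ, revTimelike f (fun s => g s + d) s θ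
      = revTimelike f g s θ + ![0, 0, d] := fun d s _ θ => by
    ext i; fin_cases i <;> simp [revTimelike]
  have hpart : ∀ d S, (∀ q : E31, ∀ s ∈ I, q 2 = g s + d → (q ∈ S ↔ q 0 ^ 2 + q 1 ^ 2 = f s ^ 2)) →
      IsOpenPart (trace I (revTimelike f (fun s => g s + d))) S := fun d S hS =>
    isOpenPart_revTimelike hf0 (isOpen_image_add_const hI hg hg0 d) hS
  rcases h with ⟨hx, hy, c, hc0, h⟩ | ⟨k, hk, d, ⟨h3, h4, h⟩ | ⟨h3, h4, h⟩ | ⟨h3, h4, h⟩⟩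
  · right; right
    rcases sq_eq_one_iff.1 hη with hη | hη
    · right
      refine ⟨c, hc0, isOpenPart_sphere_trace hT (u := ![0, 0, w 2]) (fun s hs θ => ?_) (hY (w 2))
        (hpart (w 2) _ fun q s hs hq => ?_)⟩
      · rw [hX s hs]
        refine congrArg (fun u => T (revTimelike f g s θ) + T u) ?_
        ext i; fin_cases i <;> simp [hx, hy]
      · have h5 := h s hs
        rw [← hq, hη] at h5
        simp only [Set.mem_ofPred_eq, lorentz]
        constructor <;> intro h'
        · linear_combination h' - h5
        · linear_combination h' + h5
    · left
      refine ⟨c, hc0, isOpenPart_sphere_trace hT (u := ![0, 0, w 2]) (fun s hs θ => ?_) (hY (w 2))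
        (hpart (w 2) _ fun q s hs hq => ?_)⟩
      · rw [hX s hs]
        refine congrArg (fun u => T (revTimelike f g s θ) + T u) ?_
        ext i; fin_cases i <;> simp [hx, hy]
      · have h5 := h s hs
        rw [← hq, hη] at h5
        simp only [Set.mem_ofPred_eq, lorentz]
        constructor <;> intro h'
        · linear_combination h' - h5
        · linear_combination h' + h5
  · exfalso; linarith
  · left
    refine isOpenPartOfCopy_trace hT hX (hY d) hk (hpart d _ fun q s hs hq => ?_)
    have h0 := pow_pos (hf0 s hs) 2
    rw [h s hs] at h0 ⊢
    rw [← hq] at h0 ⊢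
    exact and_iff_left fun h5 => by simp [h5] at h0
  · right; left
    refine isOpenPartOfCopy_trace hT hX (hY d) hk (hpart d _ fun q s hs hq => ?_)
    have h0 := pow_pos (hf0 s hs) 2
    rw [h s hs] at h0 ⊢
    rw [← hq] at h0 ⊢
    exact and_iff_left fun h5 => by simp [h5] at h0

theorem classification_null (hI : IsOpen I) (hc : IsConnected I)
    (hf : ContDiffOn ℝ ∞ f I) (hg : ContDiffOn ℝ ∞ g I) (hfg : ∀ s ∈ I, f s - g s ≠ 0)
    (hT : ∀ u w, lorentz (T u) (T w) = lorentz u w)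
    (hX : ∀ s ∈ I, ∀ θ, X s θ = T (revNull f g s θ) + T w)
    (h₁ : ∀ s ∈ I, ∀ θ, (firstForm X s θ).det ≠ 0)
    (h₂ : ∀ s ∈ I, ∀ θ, (secondForm X s θ).det ≠ 0)
    (hA : ∀ s ∈ I, ∀ θ : ℝ, ∀ i : Fin 3,
      laplaceIII X (fun s θ => X s θ i) s θ = A.mulVec (X s θ) i) :
    IsOpenPartOfCopy (trace I X) enneper₂ ∨ IsOpenPartOfCopy (trace I X) enneper₃ ∨
      (∃ c, 0 < c ∧ IsOpenPart (trace I X) (pseudosphere c)) ∨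
      ∃ c, 0 < c ∧ IsOpenPart (trace I X) (hyperbolicSpace c) := by
  obtain ⟨hh0, η, hη, h⟩ := (rotationFrame_null.map hT).null_classification
    (p := fun s => f s - g s) (r := fun s => f s + g s)
    (χ := -1 * LinearMap.det T) (x := w 2 - w 1) (y := w 0) (z := w 1 + w 2) (v := T w)
    (by rw [mul_pow, det_sq_of_lorentz hT]; norm_num)
    (fun θ => cross_map hT (by ext i; fin_cases i <;> simp [cross] <;> ring))
    (fun θ => by
      rw [cross_map hT (e := ![0, 1 / 2, 1 / 2]) (k := 1) (by
        ext i; fin_cases i <;> simp [cross])]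
      congr 1; ring)
    hI hc (hf.sub hg) (hf.add hg) hfg
    (fun s hs θ => by
      rw [hX s hs, ← map_smul, ← map_smul, ← map_add, ← map_add, ← map_add]
      refine congrArg T ?_
      ext i; fin_cases i <;> simp [revNull] <;> ring)
    h₁ h₂
    (by
      rw [← map_smul, ← map_smul, ← map_smul, ← map_add, ← map_add]
      refine congrArg T ?_
      ext i; fin_cases i <;> simp <;> ring) hA
  have hY : ∀ d, ∀ s ∈ I, ∀ θ, revNull (fun s => f s + d / 2) (fun s => g s + d / 2) s θ
      = revNull f g s θ + ![0, d / 2, d / 2] := fun d s _ θ => by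
    ext i; fin_cases i <;> simp [revNull] <;> ring
  -- On the surface `x ^ 2 + y ^ 2 - z ^ 2 = -p (r + d)`. The cubic profile makes this `-η k p ^ 4`,
  -- the Enneper equation, and a constant product gives a sphere.
  have hpart : ∀ d S, (∀ q : E31, ∀ s ∈ I, q 2 - q 1 = f s - g s →
      (q ∈ S ↔ q 0 ^ 2 + q 1 ^ 2 - q 2 ^ 2 = -((f s - g s) * (f s + g s + d)))) →
      IsOpenPart (trace I (revNull (fun s => f s + d / 2) (fun s => g s + d / 2))) S :=
    fun d S hS => by
    have hd : ∀ s, (f s + d / 2) - (g s + d / 2) = f s - g s := fun s => by ring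
    refine isOpenPart_revNull (fun s hs => by rw [hd]; exact hfg s hs) ?_ fun q s hs hq => ?_
    · simp only [hd]
      exact isOpen_image_of_deriv_ne_zero hI (hf.sub hg) hh0
    · rw [hS q s hs (by rw [hq, hd])]
      have : -((f s - g s) * (f s + g s + d)) = (g s + d / 2) ^ 2 - (f s + d / 2) ^ 2 := by ring
      rw [this]
  rcases h with ⟨hx, hy, c, hc0, h⟩ | ⟨k, hk, d, h⟩
  · have hw : ∀ s ∈ I, ∀ θ, X s θ
        = T (revNull f g s θ) + T ![0, (w 1 + w 2) / 2, (w 1 + w 2) / 2] := fun s hs θ => by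
      rw [hX s hs]
      refine congrArg (fun u => T (revNull f g s θ) + T u) ?_
      ext i
      fin_cases i <;> simp
      · exact hy
      · linear_combination -hx / 2
      · linear_combination hx / 2
    have hsph : ∀ K, K = -η * c ^ 2 → IsOpenPart (trace I X) {q | lorentz q q = K} := fun K hK =>
      isOpenPart_sphere_trace hT hw (hY (w 1 + w 2)) (hpart (w 1 + w 2) _ fun q s hs hq => by
        rw [h s hs, Set.mem_ofPred_eq, lorentz, hK]
        constructor <;> intro h' <;> linear_combination h')
    right; right
    rcases hη with hη | hη
    · exact Or.inr ⟨c, hc0, hsph _ (by rw [hη]; ring)⟩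
    · exact Or.inl ⟨c, hc0, hsph _ (by rw [hη]; ring)⟩
  · have hcopy : ∀ (S : ℝ → Set E31), (∀ q : E31, q 1 - q 2 ≠ 0 → (q ∈ S k ↔
        q 0 ^ 2 + q 1 ^ 2 - q 2 ^ 2 = -η * k * (q 1 - q 2) ^ 4)) →
        IsOpenPartOfCopy (trace I X) S := fun S hS =>
      isOpenPartOfCopy_trace hT hX (hY d) hk (hpart d _ fun q s hs hq => by
        have h0 := hfg s hs
        rw [← hq] at h0
        rw [hS q fun h6 => h0 (by linear_combination -h6), h s hs, ← hq]
        constructor <;> intro h' <;> linear_combination h')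
    rcases hη with hη | hη
    · exact Or.inr (Or.inl (hcopy _ fun q hq => by
        rw [hη, neg_one_mul]; exact and_iff_left hq))
    · exact Or.inl (hcopy _ fun q hq => by
        rw [hη, neg_neg, one_mul]; exact and_iff_left hq)

end

end Minkowski3

end

theorem mainTheorem4 (I : Set ℝ) (X : ℝ → ℝ → Minkowski3.E31)
    (hX : Minkowski3.IsSurfaceOfRevolution I X)
    (hK : ∀ s ∈ I, ∀ θ : ℝ, (Minkowski3.secondForm X s θ).det ≠ 0)
    (A : Matrix (Fin 3) (Fin 3) ℝ)
    (hA : ∀ s ∈ I, ∀ θ : ℝ, ∀ i : Fin 3,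
      Minkowski3.laplaceIII X (fun s θ => X s θ i) s θ = A.mulVec (X s θ) i) :
    (Minkowski3.IsOpenPartOfCopy (Minkowski3.trace I X) Minkowski3.catenoid₁ ∨
      Minkowski3.IsOpenPartOfCopy (Minkowski3.trace I X) Minkowski3.catenoid₂ ∨
      Minkowski3.IsOpenPartOfCopy (Minkowski3.trace I X) Minkowski3.catenoid₃ ∨
      Minkowski3.IsOpenPartOfCopy (Minkowski3.trace I X) Minkowski3.catenoid₄ ∨
      Minkowski3.IsOpenPartOfCopy (Minkowski3.trace I X) Minkowski3.catenoid₅) ∨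
    (Minkowski3.IsOpenPartOfCopy (Minkowski3.trace I X) Minkowski3.enneper₂ ∨
      Minkowski3.IsOpenPartOfCopy (Minkowski3.trace I X) Minkowski3.enneper₃) ∨
    (∃ c : ℝ, 0 < c ∧
      Minkowski3.IsOpenPart (Minkowski3.trace I X) (Minkowski3.pseudosphere c)) ∨
    (∃ c : ℝ, 0 < c ∧
      Minkowski3.IsOpenPart (Minkowski3.trace I X) (Minkowski3.hyperbolicSpace c)) := by
  obtain ⟨hI, hc, ⟨f, g, Y, φ, hf, hg, hY, ⟨T, v, hT, hφ⟩, hXY⟩, h₁⟩ := hX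
  -- Writing the translation as `T w` gives it coordinates in the transported frame.
  obtain ⟨w, rfl⟩ := Minkowski3.surjective_of_lorentz hT v
  simp only [hφ] at hXY
  rcases hY with ⟨h0, rfl⟩ | ⟨h0, rfl⟩ | ⟨h0, rfl⟩ | ⟨h0, rfl⟩
  · rcases Minkowski3.classification_spacelike₁ hI hc hf hg h0 hT hXY h₁ hK hA with h | h
    · exact Or.inl (Or.inr (Or.inr (Or.inr (Or.inr h))))
    · exact Or.inr (Or.inr (Or.inl h))
  · rcases Minkowski3.classification_spacelike₂ hI hc hf hg h0 hT hXY h₁ hK hA with h | h | h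
    · exact Or.inl (Or.inr (Or.inl h))
    · exact Or.inl (Or.inr (Or.inr (Or.inr (Or.inl h))))
    · exact Or.inr (Or.inr h)
  · rcases Minkowski3.classification_timelike hI hc hf hg h0 hT hXY h₁ hK hA with h | h | h
    · exact Or.inl (Or.inl h)
    · exact Or.inl (Or.inr (Or.inr (Or.inl h)))
    · exact Or.inr (Or.inr h)
  · rcases Minkowski3.classification_null hI hc hf hg h0 hT hXY h₁ hK hA with h | h | h
    · exact Or.inr (Or.inl (Or.inl h))
    · exact Or.inr (Or.inl (Or.inr h))
    · exact Or.inr (Or.inr h)
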